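/- Let $\Gamma\subset\mathrm{SL}(2,\mathbb{R})$ be a discrete subgroup with $-1\in\Gamma$ such that the hyperbolic surface $\mathcal{Y}=\Gamma\backslash\mathbb{H}$ has finite area and $K\geq 1$ cusps. Identify its unit tangent bundle with $\mathcal{X}=\Gamma\backslash\mathrm{SL}(2,\mathbb{R})$, and let $\mu$ be the normalised Liouville measure, i.e. the probability measure on $\mathcal{X}$ induced by Haar measure on $\mathrm{SL}(2,\mathbb{R})$. Let $$\varphi_t(x)=x\begin{pmatrix}e^{t/2}&0\\0&e^{-t/2}\end{pmatrix},\qquad h^+_s(x)=x\begin{pmatrix}1&0\\-s&1\end{pmatrix},\qquad h^-_s(x)=x\begin{pmatrix}1&s\\0&1\end{pmatrix}$$ be the geodesic, unstable horocycle and stable horocycle flows. For each cusp $\kappa\in[K]=\{1,\dots,K\}$ let $\mathcal{C}_\kappa$ be the closed stable horocycle of length one around the cusp $\kappa$, with vectors pointing towards the cusp, and fix $x_\kappa\in\mathcal{C}_\kappa$. For $\sigma\in\mathbb{R}^K$ and $R\in\mathbb{R}$ set $$\mathcal{H}_\kappa(R)=\bigcup_{t\geq R}\varphi_t(\mathcal{C}_\kappa),\qquad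 \mathcal{H}(\sigma,R)=\bigcup_{\kappa=1}^K\mathcal{H}_\kappa(\sigma_\kappa+R),$$ $$\Sigma^K(\sigma)=\{(s,t,\kappa): s\in[0,1),\ t\geq\sigma_\kappa,\ \kappa\in[K]\},\qquad \iota_{\sigma,R}(s,t,\kappa)=\varphi_{t+R}(h^-_s(x_\kappa)),$$ and let $\nu_\sigma$ be the measure on $\Sigma^K(\sigma)$ given by $e^{-t}\,ds\,dt$ on each sheet $\{\kappa=\mathrm{const}\}$. Let $\xi_1(x,\sigma,R)\in(0,\infty]$ be the first time $r>0$ with $h^+_r(x)\in\mathcal{H}(\sigma,R)$ and, if it is finite, let $(w_1,\kappa_1)(x,\sigma,R)\in\Sigma^K(\sigma)$ be the parameter of the point hit, $\iota_{\sigma,R}(w_1,\kappa_1)=h^+_{\xi_1}(x)$. Let $\eta_1(w,\kappa,\sigma)$ and $\eta_{-1}(w,\kappa,\sigma)$ be the first $r>0$ for which $h^+_{r}(\iota_{\sigma,0}(w,\kappa))$, respectively $h^+_{-r}(\iota_{\sigma,0}(w,\kappa))$, lies in $\mathcal{H}(\sigma,0)$, and put $\overline\eta_1(\sigma)=\int_{\Sigma^K(\sigma)}\eta_1\,d\nu_\sigma$.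 Let $\lambda$ be a Borel probability measure on $\mathcal{X}$ that is admissible: $\lim_{t\to\infty}\lambda(\varphi_t\mathcal{E})=\mu(\mathcal{E})$ for every Borel set $\mathcal{E}\subset\mathcal{X}$ with $\mu(\partial\mathcal{E})=0$. Fix $\sigma\in\mathbb{R}^K$. Then $$\Psi_\sigma(r,w,\kappa)=\frac{1}{\overline\eta_1(\sigma)}\,\mathbf{1}\bigl(r<\eta_{-1}(w,\kappa,\sigma)\bigr)$$ is an $L^1$ probability density on $\mathbb{R}_{>0}\times\Sigma^K(\sigma)$ with respect to $dr\otimes\nu_\sigma$, and for every $X>0$ and every Borel set $\mathcal{D}\subset\Sigma^K(\sigma)$ with boundary of Lebesgue measure zero, $$\lim_{R\to\infty}\lambda\bigl\{x_0\in\mathcal{X}: e^{-R}\xi_1(x_0,\sigma,R)>X,\ (w_1,\kappa_1)(x_0,\sigma,R)\in\mathcal{D}\bigr\}=\int_X^\infty\int_{\mathcal{D}}\Psi_\sigma(r,w,\kappa)\,\nu_\sigma(dw,\{\kappa\})\,dr .$$ -/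

import Mathlib

open MeasureTheory Filter Topology Set

noncomputable section

namespace CuspHitting

/-- The group `SL(2, ℝ)`. -/
abbrev SL2R : Type := Matrix.SpecialLinearGroup (Fin 2) ℝ

instance instMeasurableSpaceSL2R : MeasurableSpace SL2R := borel SL2R

instance instBorelSpaceSL2R : BorelSpace SL2R := ⟨rfl⟩

/-- The space `Γ \ SL(2, ℝ)` of cosets `Γ g`. If `Γ` is discrete and contains `-1`, this is the
unit tangent bundle of the hyperbolic surface (orbifold) `Γ \ ℍ`. -/
def CosetSpace (Γ : Subgroup SL2R) : Type := Quotient (QuotientGroup.rightRel Γ)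

/-- The coset `Γ g`. -/
def toCoset (Γ : Subgroup SL2R) (g : SL2R) : CosetSpace Γ :=
  Quotient.mk (QuotientGroup.rightRel Γ) g

/-- The quotient topology. -/
instance instTopologicalSpaceCosetSpace (Γ : Subgroup SL2R) : TopologicalSpace (CosetSpace Γ) :=
  inferInstanceAs (TopologicalSpace (Quotient (QuotientGroup.rightRel Γ)))

/-- The Borel σ-algebra of the quotient topology. -/
instance instMeasurableSpaceCosetSpace (Γ : Subgroup SL2R) : MeasurableSpace (CosetSpace Γ) :=
  borel (CosetSpace Γ)

instance instBorelSpaceCosetSpace (Γ : Subgroup SL2R) : BorelSpace (CosetSpace Γ) := ⟨rfl⟩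

/-- Right translation `Γ g ↦ Γ g a`. -/
def rightTranslate (Γ : Subgroup SL2R) (a : SL2R) : CosetSpace Γ → CosetSpace Γ :=
  Quotient.map (· * a) (by
    intro x y h
    have h' : QuotientGroup.rightRel Γ x y := h
    rw [QuotientGroup.rightRel_apply] at h'
    show QuotientGroup.rightRel Γ (x * a) (y * a)
    rw [QuotientGroup.rightRel_apply]
    simpa [mul_assoc] using h')

/-- The matrix `diag (e^{t/2}, e^{-t/2})`. -/
def diagMatrix (t : ℝ) : SL2R :=
  ⟨!![Real.exp (t / 2), 0; 0, Real.exp (-t / 2)], by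
    rw [Matrix.det_fin_two_of, ← Real.exp_add]; ring_nf; simp⟩

/-- The matrix with rows `(1, s)` and `(0, 1)`. -/
def upperMatrix (s : ℝ) : SL2R := ⟨!![1, s; 0, 1], by simp [Matrix.det_fin_two_of]⟩

/-- The matrix with rows `(1, 0)` and `(-s, 1)`. -/
def lowerMatrix (s : ℝ) : SL2R := ⟨!![1, 0; -s, 1], by simp [Matrix.det_fin_two_of]⟩

/-- The geodesic flow `φ_t`. -/
def geodesicFlow (Γ : Subgroup SL2R) (t : ℝ) : CosetSpace Γ → CosetSpace Γ :=
  rightTranslate Γ (diagMatrix t)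

/-- The unstable horocycle flow `h⁺_s`. -/
def unstableFlow (Γ : Subgroup SL2R) (s : ℝ) : CosetSpace Γ → CosetSpace Γ :=
  rightTranslate Γ (lowerMatrix s)

/-- The stable horocycle flow `h⁻_s`. -/
def stableFlow (Γ : Subgroup SL2R) (s : ℝ) : CosetSpace Γ → CosetSpace Γ :=
  rightTranslate Γ (upperMatrix s)

/-- The measure on `Γ \ SL(2, ℝ)` induced by a Haar measure `m` on `SL(2, ℝ)` and a fundamental
domain `F` of `Γ`; for `m F = 1` it is the normalised Liouville measure. -/
def liouville (Γ : Subgroup SL2R) (m : Measure SL2R) (F : Set SL2R) : Measure (CosetSpace Γ) :=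
  (m.restrict F).map (toCoset Γ)

/-- `lam (φ_t E) → μ E` as `t → ∞` for all Borel sets `E` with `μ`-null boundary. -/
def IsAdmissible (Γ : Subgroup SL2R) (μ lam : Measure (CosetSpace Γ)) : Prop :=
  ∀ E : Set (CosetSpace Γ), MeasurableSet E → μ (frontier E) = 0 →
    Tendsto (fun t : ℝ => lam (geodesicFlow Γ t '' E)) atTop (𝓝 (μ E))

/-- The point of `ℝ ∪ {∞}`, the boundary of the upper half plane, to which the geodesic with
initial data `g` tends in forward time. -/
def endpoint (g : SL2R) : OnePoint ℝ :=
  Matrix.SpecialLinearGroup.toGL g • (OnePoint.infty : OnePoint ℝ)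

/-- The points `Γ g_1, …, Γ g_K` lie on the closed stable horocycles of length one around the
cusps of `Γ`, exactly one for each cusp (that is, for each `Γ`-orbit of parabolic fixed points). -/
structure IsCuspSystem (Γ : Subgroup SL2R) {K : ℕ} (g : Fin K → SL2R) : Prop where
  isCusp : ∀ κ, IsCusp (endpoint (g κ)) (Γ.map Matrix.SpecialLinearGroup.toGL)
  existsUnique : ∀ c : OnePoint ℝ, IsCusp c (Γ.map Matrix.SpecialLinearGroup.toGL) →
    ∃! κ, ∃ γ ∈ Γ, Matrix.SpecialLinearGroup.toGL γ • c = endpoint (g κ)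
  length_one : ∀ κ (s : ℝ),
    stableFlow Γ s (toCoset Γ (g κ)) = toCoset Γ (g κ) ↔ ∃ n : ℤ, s = n

section Sections

variable (Γ : Subgroup SL2R) {K : ℕ} (g : Fin K → SL2R) (σ : Fin K → ℝ) (R : ℝ)

/-- The stable horocycle `C_κ` through `x_κ = Γ g_κ`. -/
def cuspHorocycle (κ : Fin K) : Set (CosetSpace Γ) :=
  range fun s : ℝ => stableFlow Γ s (toCoset Γ (g κ))

/-- The section `H_κ(R)`, the union of the `φ_t(C_κ)` with `t ≥ R`. -/
def cuspSection (κ : Fin K) : Set (CosetSpace Γ) :=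
  ⋃ t ∈ Ici R, geodesicFlow Γ t '' cuspHorocycle Γ g κ

/-- The union `H(σ, R)` of the sections `H_κ(σ_κ + R)`. -/
def multiSection : Set (CosetSpace Γ) :=
  ⋃ κ, cuspSection Γ g (σ κ + R) κ

/-- The parameter domain of all `(s, t, κ)` with `0 ≤ s < 1` and `t ≥ σ_κ`. -/
def paramDomain : Set (ℝ × ℝ × Fin K) :=
  {w | w.1 ∈ Ico (0 : ℝ) 1 ∧ σ w.2.2 ≤ w.2.1}

/-- The parametrisation `(s, t, κ) ↦ φ_{t+R} (h⁻_s (x_κ))` of `H(σ, R)`. -/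
def param (w : ℝ × ℝ × Fin K) : CosetSpace Γ :=
  geodesicFlow Γ (w.2.1 + R) (stableFlow Γ w.1 (toCoset Γ (g w.2.2)))

/-- The first time `r > 0` at which the forward orbit of `x` under the unstable horocycle flow
is in `H(σ, R)`; it is `∞` if there is no such time. -/
def hittingTime (x : CosetSpace Γ) : ENNReal :=
  ⨅ r ∈ {r : ℝ | 0 < r ∧ unstableFlow Γ r x ∈ multiSection Γ g σ R}, ENNReal.ofReal r

/-- The first time `r > 0` at which the backward orbit of `x` under the unstable horocycle flow
is in `H(σ, R)`; it is `∞` if there is no such time. -/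
def backwardHittingTime (x : CosetSpace Γ) : ENNReal :=
  ⨅ r ∈ {r : ℝ | 0 < r ∧ unstableFlow Γ (-r) x ∈ multiSection Γ g σ R}, ENNReal.ofReal r

/-- `w` is the impact parameter of the first hit: the first hitting time of `x` is finite, and the
location of the first hit is the point of `H(σ, R)` with parameter `w`. -/
def IsFirstImpact (x : CosetSpace Γ) (w : ℝ × ℝ × Fin K) : Prop :=
  hittingTime Γ g σ R x ≠ ⊤ ∧ w ∈ paramDomain σ ∧
    param Γ g R w = unstableFlow Γ (hittingTime Γ g σ R x).toReal x

/-- The first return time `η₁` to `H(σ, 0)`. -/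
def returnTime (w : ℝ × ℝ × Fin K) : ENNReal :=
  hittingTime Γ g σ 0 (param Γ g 0 w)

/-- The first backward return time `η₋₁` to `H(σ, 0)`. -/
def backwardReturnTime (w : ℝ × ℝ × Fin K) : ENNReal :=
  backwardHittingTime Γ g σ 0 (param Γ g 0 w)

/-- Lebesgue measure `ds dt` on each of the `K` sheets of `ℝ × ℝ × {1, …, K}`. -/
def sheetLebesgue (K : ℕ) : Measure (ℝ × ℝ × Fin K) :=
  (volume : Measure ℝ).prod ((volume : Measure ℝ).prod Measure.count)

/-- The measure `e^{-t} ds dt` on each sheet of the parameter domain. -/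
def sectionMeasure : Measure (ℝ × ℝ × Fin K) :=
  ((sheetLebesgue K).restrict (paramDomain σ)).withDensity
    fun w => ENNReal.ofReal (Real.exp (-w.2.1))

/-- The integral of the first return time over the section. -/
def meanReturnTime : ENNReal :=
  ∫⁻ w, returnTime Γ g σ w ∂(sectionMeasure σ)

open Classical in
/-- The limit density. -/
def limitDensity (r : ℝ) (w : ℝ × ℝ × Fin K) : ℝ :=
  if ENNReal.ofReal r < backwardReturnTime Γ g σ w then 1 / (meanReturnTime Γ g σ).toReal else 0

end Sections

end CuspHitting

end

/-!
Right translation by `φ_R` turns the event at level `R` into the `φ_R`-image of a fixed subset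
`impactSet` of `Γ \ SL(2, ℝ)`, so admissibility gives convergence to the Liouville measure of that
set as soon as its boundary is null.

To compute this measure, flow the section backwards: `(r, w) ↦ h⁺_{-r}(ι(w))`, `0 < r ≤ η₋₁(w)`,
is an injective flow box. In the cell coordinates `h⁻_s φ_t h⁺_r` Haar measure is a multiple of
`e^{-t} ds dt dr`, so Liouville measure is a multiple of `dr ⊗ ν_σ` in the flow box. The box has
full measure, because almost every orbit hits the section; running it in the opposite time
direction, with `0 < r ≤ η₁(w)`, identifies the multiple as `1 / η̄₁(σ)`.

Hits can be read off from row vectors: the orbit of `Γ h` hits the section of the cusp `κ` at time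
`r` if and only if some `p ∈ (0, 1) g_κ⁻¹ Γ` satisfies `(p h)₀ = r (p h)₁` and
`0 < (p h)₁ ≤ e^{-σ_κ / 2}`. The set of `h` for which no `p h` lies in the strip
`{0 < v₀, 0 < v₁ ≤ δ}` has translates by the flows that decrease to the corresponding set for the
half plane `{0 < v₁}`, which is null; since the flows preserve the measure, almost every orbit hits.
The row vectors of a cusp form a discrete set, so the return times are lower semicontinuous, and
this makes the boundary of the impact set null.
-/

noncomputable section

namespace CuspHitting

open scoped Matrix Pointwise

/-! ### The group `SL(2, ℝ)` -/

theorem SL2R.mul_entry (A B : SL2R) (i j : Fin 2) :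
    (A * B) i j = A i 0 * B 0 j + A i 1 * B 1 j := by
  rw [Matrix.SpecialLinearGroup.coe_mul, Matrix.mul_apply, Fin.sum_univ_two]

theorem SL2R.det_entries (A : SL2R) : A 0 0 * A 1 1 - A 0 1 * A 1 0 = 1 := by
  rw [← Matrix.det_fin_two, A.det_coe]

theorem SL2R.ext_of_ne_zero {A B : SL2R} (h01 : A 0 1 = B 0 1) (h10 : A 1 0 = B 1 0)
    (h11 : A 1 1 = B 1 1) (hne : A 1 1 ≠ 0) : A = B := by
  have h00 : A 0 0 = B 0 0 := mul_right_cancel₀ hne (by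
    linear_combination A.det_entries - B.det_entries + B 0 1 * h10 + A 1 0 * h01 - B 0 0 * h11)
  ext i j
  fin_cases i <;> fin_cases j <;> assumption

@[simp] theorem coe_diagMatrix (t : ℝ) : (diagMatrix t : Matrix (Fin 2) (Fin 2) ℝ) =
    !![Real.exp (t / 2), 0; 0, Real.exp (-t / 2)] := rfl

@[simp] theorem coe_upperMatrix (s : ℝ) :
    (upperMatrix s : Matrix (Fin 2) (Fin 2) ℝ) = !![1, s; 0, 1] := rfl

@[simp] theorem coe_lowerMatrix (r : ℝ) :
    (lowerMatrix r : Matrix (Fin 2) (Fin 2) ℝ) = !![1, 0; -r, 1] := rfl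

theorem upperMatrix_add (s t : ℝ) : upperMatrix (s + t) = upperMatrix s * upperMatrix t :=
  Subtype.ext (by simp [add_comm])

theorem lowerMatrix_add (s t : ℝ) : lowerMatrix (s + t) = lowerMatrix s * lowerMatrix t :=
  Subtype.ext (by simp [add_comm])

theorem diagMatrix_add (s t : ℝ) : diagMatrix (s + t) = diagMatrix s * diagMatrix t :=
  Subtype.ext (by simp [← Real.exp_add, add_div, add_comm])

@[simp] theorem upperMatrix_zero : upperMatrix 0 = 1 :=
  Subtype.ext (by simp [Matrix.one_fin_two])

@[simp] theorem lowerMatrix_zero : lowerMatrix 0 = 1 :=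
  Subtype.ext (by simp [Matrix.one_fin_two])

@[simp] theorem diagMatrix_zero : diagMatrix 0 = 1 :=
  Subtype.ext (by simp [Matrix.one_fin_two])

theorem upperMatrix_neg (s : ℝ) : upperMatrix (-s) = (upperMatrix s)⁻¹ := by
  rw [eq_inv_iff_mul_eq_one, ← upperMatrix_add, neg_add_cancel, upperMatrix_zero]

theorem lowerMatrix_neg (s : ℝ) : lowerMatrix (-s) = (lowerMatrix s)⁻¹ := by
  rw [eq_inv_iff_mul_eq_one, ← lowerMatrix_add, neg_add_cancel, lowerMatrix_zero]

theorem diagMatrix_neg (s : ℝ) : diagMatrix (-s) = (diagMatrix s)⁻¹ := by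
  rw [eq_inv_iff_mul_eq_one, ← diagMatrix_add, neg_add_cancel, diagMatrix_zero]

theorem diagMatrix_mul_lowerMatrix (t r : ℝ) :
    diagMatrix t * lowerMatrix r = lowerMatrix (Real.exp (-t) * r) * diagMatrix t := by
  have h : Real.exp (-t) * r * Real.exp (t / 2) = Real.exp (-t / 2) * r := by
    rw [mul_right_comm, ← Real.exp_add]; ring_nf
  exact Subtype.ext (by simp [h])

theorem diagMatrix_mul_upperMatrix (t s : ℝ) :
    diagMatrix t * upperMatrix s = upperMatrix (Real.exp t * s) * diagMatrix t := by
  have h : Real.exp t * s * Real.exp (-t / 2) = Real.exp (t / 2) * s := by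
    rw [mul_right_comm, ← Real.exp_add]; ring_nf
  exact Subtype.ext (by simp [h])

theorem isClosedEmbedding_coe_SL2R :
    IsClosedEmbedding ((↑) : SL2R → Matrix (Fin 2) (Fin 2) ℝ) :=
  Matrix.SpecialLinearGroup.isClosedEmbedding_val

@[fun_prop]
theorem continuous_upperMatrix : Continuous upperMatrix :=
  Continuous.subtype_mk (by fun_prop) _

@[fun_prop]
theorem continuous_lowerMatrix : Continuous lowerMatrix :=
  Continuous.subtype_mk (by fun_prop) _

@[fun_prop]
theorem continuous_diagMatrix : Continuous diagMatrix :=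
  Continuous.subtype_mk (by fun_prop) _

instance : LocallyCompactSpace SL2R :=
  haveI : LocallyCompactSpace (Matrix (Fin 2) (Fin 2) ℝ) :=
    inferInstanceAs (LocallyCompactSpace (Fin 2 → Fin 2 → ℝ))
  isClosedEmbedding_coe_SL2R.locallyCompactSpace

instance : PolishSpace SL2R :=
  haveI : PolishSpace (Matrix (Fin 2) (Fin 2) ℝ) :=
    inferInstanceAs (PolishSpace (Fin 2 → Fin 2 → ℝ))
  isClosedEmbedding_coe_SL2R.polishSpace

/-- The coordinates `(r, s, t)` on the open cell of matrices with positive lower right entry. -/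
def cell (q : ℝ × ℝ × ℝ) : SL2R := upperMatrix q.2.1 * diagMatrix q.2.2 * lowerMatrix (-q.1)

theorem cell_01 (q : ℝ × ℝ × ℝ) : cell q 0 1 = q.2.1 * Real.exp (-q.2.2 / 2) := by
  simp [cell]

theorem cell_10 (q : ℝ × ℝ × ℝ) : cell q 1 0 = q.1 * Real.exp (-q.2.2 / 2) := by
  simp [cell, mul_comm]

theorem cell_11 (q : ℝ × ℝ × ℝ) : cell q 1 1 = Real.exp (-q.2.2 / 2) := by
  simp [cell]

theorem continuous_cell : Continuous cell := by
  unfold cell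
  fun_prop

/-- The inverse of `cell`, with junk values where the lower right entry is not positive. -/
def cellCoord (A : SL2R) : ℝ × ℝ × ℝ :=
  (A 1 0 / A 1 1, A 0 1 / A 1 1, -2 * Real.log (A 1 1))

theorem cellCoord_cell (q : ℝ × ℝ × ℝ) : cellCoord (cell q) = q := by
  simp only [cellCoord, cell_01, cell_10, cell_11, Real.log_exp,
    mul_div_cancel_right₀ _ (Real.exp_pos _).ne']
  ext <;> ring

theorem cell_cellCoord {A : SL2R} (hA : 0 < A 1 1) : cell (cellCoord A) = A := by
  have h : Real.exp (-(-2 * Real.log (A 1 1)) / 2) = A 1 1 := by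
    rw [show -(-2 * Real.log (A 1 1)) / 2 = Real.log (A 1 1) by ring, Real.exp_log hA]
  apply SL2R.ext_of_ne_zero
  · rw [cell_01, cellCoord, h, div_mul_cancel₀ _ hA.ne']
  · rw [cell_10, cellCoord, h, div_mul_cancel₀ _ hA.ne']
  · rw [cell_11, cellCoord, h]
  · rw [cell_11]
    exact (Real.exp_pos _).ne'

theorem continuousOn_cellCoord : ContinuousOn cellCoord {A | 0 < A 1 1} := by
  have hne : ∀ A ∈ {A : SL2R | 0 < A 1 1}, A 1 1 ≠ 0 := fun A hA => ne_of_gt hA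
  have hentry (i j : Fin 2) : ContinuousOn (fun A : SL2R => A i j) {A | 0 < A 1 1} :=
    Continuous.continuousOn (by fun_prop)
  exact ((hentry 1 0).div (hentry 1 1) hne).prodMk
    (((hentry 0 1).div (hentry 1 1) hne).prodMk
      (continuousOn_const.mul ((hentry 1 1).log hne)))

theorem isOpenMap_cell : IsOpenMap cell := by
  intro U hU
  have himage : cell '' U = {A : SL2R | 0 < A 1 1} ∩ cellCoord ⁻¹' U := by
    refine Subset.antisymm ?_ fun A ⟨hA, hAU⟩ => ⟨_, hAU, cell_cellCoord hA⟩
    rintro _ ⟨q, hq, rfl⟩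
    refine ⟨?_, by rwa [mem_preimage, cellCoord_cell]⟩
    rw [mem_ofPred_eq, cell_11]
    exact Real.exp_pos _
  rw [himage]
  exact continuousOn_cellCoord.isOpen_inter_preimage
    (isOpen_lt continuous_const (by fun_prop)) hU

theorem isOpenEmbedding_cell : IsOpenEmbedding cell :=
  .of_continuous_injective_isOpenMap continuous_cell
    (Function.LeftInverse.injective cellCoord_cell) isOpenMap_cell

/-! ### The coset space -/

section Coset

variable (Γ : Subgroup SL2R)

theorem toCoset_eq_iff {a b : SL2R} : toCoset Γ a = toCoset Γ b ↔ ∃ γ ∈ Γ, γ * a = b := by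
  have h : toCoset Γ a = toCoset Γ b ↔ QuotientGroup.rightRel Γ a b :=
    Quotient.eq (r := QuotientGroup.rightRel Γ)
  rw [h, QuotientGroup.rightRel_apply]
  refine ⟨fun hab => ⟨_, hab, by simp⟩, ?_⟩
  rintro ⟨γ, hγ, rfl⟩
  rwa [mul_inv_cancel_right]

theorem toCoset_mul_left {γ : SL2R} (hγ : γ ∈ Γ) (a : SL2R) :
    toCoset Γ (γ * a) = toCoset Γ a :=
  ((toCoset_eq_iff Γ).2 ⟨γ, hγ, rfl⟩).symm

theorem toCoset_surjective : Function.Surjective (toCoset Γ) := Quotient.mk_surjective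

@[simp] theorem geodesicFlow_toCoset (t : ℝ) (h : SL2R) :
    geodesicFlow Γ t (toCoset Γ h) = toCoset Γ (h * diagMatrix t) := rfl

@[simp] theorem unstableFlow_toCoset (t : ℝ) (h : SL2R) :
    unstableFlow Γ t (toCoset Γ h) = toCoset Γ (h * lowerMatrix t) := rfl

@[simp] theorem stableFlow_toCoset (t : ℝ) (h : SL2R) :
    stableFlow Γ t (toCoset Γ h) = toCoset Γ (h * upperMatrix t) := rfl

theorem geodesicFlow_add (s t : ℝ) (x : CosetSpace Γ) :
    geodesicFlow Γ (s + t) x = geodesicFlow Γ t (geodesicFlow Γ s x) := by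
  obtain ⟨h, rfl⟩ := toCoset_surjective Γ x
  simp only [geodesicFlow_toCoset, diagMatrix_add, mul_assoc]

@[simp] theorem geodesicFlow_zero (x : CosetSpace Γ) : geodesicFlow Γ 0 x = x := by
  obtain ⟨h, rfl⟩ := toCoset_surjective Γ x
  simp

theorem geodesicFlow_neg_geodesicFlow (t : ℝ) (x : CosetSpace Γ) :
    geodesicFlow Γ (-t) (geodesicFlow Γ t x) = x := by
  rw [← geodesicFlow_add, add_neg_cancel, geodesicFlow_zero]

theorem geodesicFlow_geodesicFlow_neg (t : ℝ) (x : CosetSpace Γ) :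
    geodesicFlow Γ t (geodesicFlow Γ (-t) x) = x := by
  rw [← geodesicFlow_add, neg_add_cancel, geodesicFlow_zero]

theorem unstableFlow_geodesicFlow (t r : ℝ) (x : CosetSpace Γ) :
    unstableFlow Γ r (geodesicFlow Γ t x) =
      geodesicFlow Γ t (unstableFlow Γ (Real.exp (-t) * r) x) := by
  obtain ⟨h, rfl⟩ := toCoset_surjective Γ x
  simp only [geodesicFlow_toCoset, unstableFlow_toCoset, mul_assoc, diagMatrix_mul_lowerMatrix]

theorem unstableFlow_add (r s : ℝ) (x : CosetSpace Γ) :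
    unstableFlow Γ (r + s) x = unstableFlow Γ s (unstableFlow Γ r x) := by
  obtain ⟨h, rfl⟩ := toCoset_surjective Γ x
  simp only [unstableFlow_toCoset, lowerMatrix_add, mul_assoc]

@[simp] theorem unstableFlow_zero (x : CosetSpace Γ) : unstableFlow Γ 0 x = x := by
  obtain ⟨h, rfl⟩ := toCoset_surjective Γ x
  simp

theorem isOpenQuotientMap_toCoset : IsOpenQuotientMap (toCoset Γ) :=
  MulAction.isOpenQuotientMap_quotientMk

theorem continuous_toCoset : Continuous (toCoset Γ) := (isOpenQuotientMap_toCoset Γ).continuous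

instance [DiscreteTopology Γ] : T2Space (CosetSpace Γ) :=
  haveI : ProperlyDiscontinuousSMul Γ SL2R :=
    Γ.properlyDiscontinuousSMul_of_tendsto_cofinite
      (Γ.tendsto_coe_cofinite_of_discrete (isDiscrete_iff_discreteTopology.mpr inferInstance))
  inferInstanceAs (T2Space (Quotient (MulAction.orbitRel Γ SL2R)))

end Coset

/-! ### Haar measure in cell coordinates -/

section Unimodular

open scoped commutatorElement

theorem upperMatrix_mem_commutator (s : ℝ) : upperMatrix s ∈ commutator SL2R := by
  have h : upperMatrix s = ⁅diagMatrix (Real.log 2), upperMatrix s⁆ := by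
    rw [commutatorElement_def, diagMatrix_mul_upperMatrix, mul_inv_cancel_right,
      ← upperMatrix_neg, ← upperMatrix_add, Real.exp_log two_pos]
    ring_nf
  rw [h]
  exact Subgroup.commutator_mem_commutator trivial trivial

theorem lowerMatrix_mem_commutator (r : ℝ) : lowerMatrix r ∈ commutator SL2R := by
  have h : lowerMatrix r = ⁅diagMatrix (-Real.log 2), lowerMatrix r⁆ := by
    rw [commutatorElement_def, diagMatrix_mul_lowerMatrix, mul_inv_cancel_right,
      ← lowerMatrix_neg, ← lowerMatrix_add, neg_neg, Real.exp_log two_pos]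
    ring_nf
  rw [h]
  exact Subgroup.commutator_mem_commutator trivial trivial

theorem diagMatrix_mem_commutator (t : ℝ) : diagMatrix t ∈ commutator SL2R := by
  let w : SL2R := ⟨!![0, 1; -1, 0], by simp [Matrix.det_fin_two_of]⟩
  have hw : w * diagMatrix (-(t / 2)) = diagMatrix (t / 2) * w := by
    refine Subtype.ext ?_
    rw [Matrix.SpecialLinearGroup.coe_mul, Matrix.SpecialLinearGroup.coe_mul]
    simp [w, neg_div]
  have h : diagMatrix t = ⁅diagMatrix (t / 2), w⁆ := by
    rw [commutatorElement_def, ← diagMatrix_neg, mul_assoc (diagMatrix _) w, hw, ← mul_assoc,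
      mul_inv_cancel_right, ← diagMatrix_add, add_halves]
  rw [h]
  exact Subgroup.commutator_mem_commutator trivial trivial

theorem mem_commutator_of_pos {A : SL2R} (hA : 0 < A 1 1) : A ∈ commutator SL2R := by
  rw [← cell_cellCoord hA]
  exact mul_mem (mul_mem (upperMatrix_mem_commutator _) (diagMatrix_mem_commutator _))
    (lowerMatrix_mem_commutator _)

theorem commutator_SL2R_eq_top : commutator SL2R = ⊤ := by
  refine (Subgroup.eq_top_iff' _).2 fun A => ?_
  obtain ⟨s, r, h⟩ : ∃ s r, 0 < (A * lowerMatrix r * upperMatrix s) 1 1 := by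
    by_cases h10 : A 1 0 = 0
    · have h11 : A 1 1 ≠ 0 := fun h11 => by simpa [h10, h11] using A.det_entries
      exact ⟨(A 1 1 - 1) / A 1 1, 1, by simp [SL2R.mul_entry, h10, mul_div_cancel₀ _ h11]⟩
    · exact ⟨(1 - A 1 1) / A 1 0, 0, by simp [SL2R.mul_entry, mul_div_cancel₀ _ h10]⟩
  have := mem_commutator_of_pos h
  rwa [Subgroup.mul_mem_cancel_right _ (upperMatrix_mem_commutator s),
    Subgroup.mul_mem_cancel_right _ (lowerMatrix_mem_commutator r)] at this

instance isMulRightInvariant_of_isHaarMeasure (m : Measure SL2R) [m.IsHaarMeasure] :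
    m.IsMulRightInvariant where
  map_mul_right_eq_self a := by
    have ha : a ∈ (Measure.modularCharacter (G := SL2R)).toHomUnits.ker :=
      Abelianization.commutator_subset_ker _ (commutator_SL2R_eq_top ▸ Subgroup.mem_top a)
    have hmod : Measure.modularCharacterFun a = 1 := congrArg Units.val ha
    rw [Measure.map_right_mul_eq_modularCharacterFun_smul, hmod, one_smul]

end Unimodular

section UnitSlice

variable {Y : Type*} [MeasurableSpace Y] (ρ : Measure (ℝ × Y))

/-- The measure `T ↦ ρ ([0, 1) × T)`. If `ρ` is invariant under translations of the first
coordinate, it is the factor that complements Lebesgue measure. -/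
def unitSlice : Measure Y := (ρ.restrict (Ico 0 1 ×ˢ univ)).map Prod.snd

instance [SFinite ρ] : SFinite (unitSlice ρ) := by
  unfold unitSlice
  infer_instance

theorem unitSlice_apply {T : Set Y} (hT : MeasurableSet T) :
    unitSlice ρ T = ρ (Ico 0 1 ×ˢ T) := by
  rw [unitSlice, Measure.map_apply measurable_snd hT, Measure.restrict_apply (measurable_snd hT),
    ← univ_prod, prod_inter_prod, univ_inter, inter_univ]

instance [TopologicalSpace Y] [OpensMeasurableSpace Y] [T2Space Y]
    [IsFiniteMeasureOnCompacts ρ] : IsFiniteMeasureOnCompacts (unitSlice ρ) where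
  lt_top_of_isCompact C hC := by
    rw [unitSlice_apply ρ hC.measurableSet]
    exact (measure_mono (prod_mono_left Ico_subset_Icc_self)).trans_lt
      (isCompact_Icc.prod hC).measure_lt_top

variable {ρ}

theorem measurePreserving_unitSlice {f : Y → Y} (hf : Measurable f)
    (hρ : MeasurePreserving (Prod.map id f) ρ ρ) :
    MeasurePreserving f (unitSlice ρ) (unitSlice ρ) := by
  refine ⟨hf, Measure.ext fun T hT => ?_⟩
  rw [Measure.map_apply hf hT, unitSlice_apply ρ (hf hT), unitSlice_apply ρ hT,
    ← hρ.measure_preimage (measurableSet_Ico.prod hT).nullMeasurableSet, preimage_prod_map_prod,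
    preimage_id]

theorem volume_prod_unitSlice [SFinite ρ]
    (hρ : ∀ u : ℝ, MeasurePreserving (fun p : ℝ × Y => (p.1 + u, p.2)) ρ ρ) :
    (volume : Measure ℝ).prod (unitSlice ρ) = ρ := by
  let f : ℝ → ENNReal := (Ico (0 : ℝ) 1).indicator 1
  have hf : Measurable f := measurable_one.indicator measurableSet_Ico
  have hf1 : ∫⁻ u, f u = 1 := by simp [f, lintegral_indicator_one measurableSet_Ico]
  refine (Measure.ext_of_lintegral _ fun φ hφ => ?_).symm
  calc ∫⁻ p, φ p ∂ρ
    _ = ∫⁻ p, ∫⁻ u, φ p * f (p.1 + u) ∂volume ∂ρ := by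
        congr 1 with p
        rw [lintegral_const_mul _ (by fun_prop), lintegral_add_left_eq_self f, hf1, mul_one]
    _ = ∫⁻ u, ∫⁻ p, φ p * f (p.1 + u) ∂ρ := lintegral_lintegral_swap (by fun_prop)
    _ = ∫⁻ u, ∫⁻ p, φ (p.1 - u, p.2) * f p.1 ∂ρ := by
        congr 1 with u
        rw [← (hρ u).lintegral_comp (f := fun p => φ (p.1 - u, p.2) * f p.1) (by fun_prop)]
        simp only [add_sub_cancel_right, Prod.mk.eta]
    _ = ∫⁻ p, ∫⁻ u, φ (p.1 - u, p.2) * f p.1 ∂volume ∂ρ := lintegral_lintegral_swap (by fun_prop)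
    _ = ∫⁻ p, (∫⁻ u, φ (u, p.2)) * f p.1 ∂ρ := by
        congr 1 with p
        rw [lintegral_mul_const _ (by fun_prop), lintegral_sub_left_eq_self fun u => φ (u, p.2)]
    _ = ∫⁻ p in Ico 0 1 ×ˢ univ, (∫⁻ u, φ (u, p.2)) ∂ρ := by
        rw [← lintegral_indicator (measurableSet_Ico.prod .univ)]
        congr 1 with p
        by_cases hp : p.1 ∈ Ico (0 : ℝ) 1 <;> simp [f, indicator, hp]
    _ = ∫⁻ y, (∫⁻ u, φ (u, y)) ∂(unitSlice ρ) := by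
        rw [unitSlice, lintegral_map (by fun_prop) measurable_snd]
    _ = ∫⁻ p, φ p ∂(volume.prod (unitSlice ρ)) := (lintegral_prod_symm' _ hφ).symm

end UnitSlice

section ExpMeasure

/-- The measure `e^{-t} dt` on the real line. -/
def expMeasure : Measure ℝ := volume.withDensity fun t => ENNReal.ofReal (Real.exp (-t))

instance : SigmaFinite expMeasure := by
  unfold expMeasure
  exact SigmaFinite.withDensity_ofReal _

theorem isAddLeftInvariant_withDensity_exp {ρ : Measure ℝ}
    (hρ : ∀ u : ℝ, ρ.map (u + ·) = ENNReal.ofReal (Real.exp u) • ρ) :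
    (ρ.withDensity fun t => ENNReal.ofReal (Real.exp t)).IsAddLeftInvariant where
  map_add_left_eq_self u := by
    let e : ℝ → ENNReal := fun t => ENNReal.ofReal (Real.exp t)
    have he : Measurable e := by fun_prop
    have hadd (s t : ℝ) : e (s + t) = e s * e t := by
      simp only [e, Real.exp_add, ENNReal.ofReal_mul (Real.exp_pos s).le]
    refine Measure.ext_of_lintegral _ fun φ hφ => ?_
    calc ∫⁻ t, φ t ∂((ρ.withDensity e).map (u + ·))
      _ = ∫⁻ t, e t * φ (u + t) ∂ρ := by
          rw [lintegral_map hφ (by fun_prop), lintegral_withDensity_eq_lintegral_mul _ he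
            (by fun_prop)]
          rfl
      _ = ∫⁻ t, e (-u) * (e t * φ t) ∂(ρ.map (u + ·)) := by
          rw [lintegral_map (by fun_prop) (by fun_prop)]
          simp only [← mul_assoc, ← hadd, neg_add_cancel_left]
      _ = ∫⁻ t, e t * φ t ∂ρ := by
          rw [hρ, lintegral_smul_measure, lintegral_const_mul _ (by fun_prop), smul_eq_mul,
            ← mul_assoc, ← hadd u, add_neg_cancel]
          simp [e]
      _ = ∫⁻ t, φ t ∂(ρ.withDensity e) := by
          rw [lintegral_withDensity_eq_lintegral_mul _ he hφ]
          rfl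

theorem exists_eq_smul_expMeasure {ρ : Measure ℝ} [IsLocallyFiniteMeasure ρ]
    (hρ : ∀ u : ℝ, ρ.map (u + ·) = ENNReal.ofReal (Real.exp u) • ρ) :
    ∃ k : NNReal, ρ = k • expMeasure := by
  let e : ℝ → ENNReal := fun t => ENNReal.ofReal (Real.exp t)
  have he : Measurable e := by fun_prop
  have : IsLocallyFiniteMeasure (ρ.withDensity e) :=
    IsLocallyFiniteMeasure.withDensity_ofReal (by fun_prop)
  have : (ρ.withDensity e).IsAddLeftInvariant := isAddLeftInvariant_withDensity_exp hρ
  have hinv : e⁻¹ = fun t => ENNReal.ofReal (Real.exp (-t)) := by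
    ext t
    simp only [e, Pi.inv_apply, ← ENNReal.ofReal_inv_of_pos (Real.exp_pos t), Real.exp_neg]
  refine ⟨(ρ.withDensity e).addHaarScalarFactor volume, ?_⟩
  calc ρ = (ρ.withDensity e).withDensity e⁻¹ :=
        (withDensity_inv_same he (.of_forall fun t => by simp [e, Real.exp_pos])
          (.of_forall fun t => ENNReal.ofReal_ne_top)).symm
    _ = ((ρ.withDensity e).addHaarScalarFactor volume • volume).withDensity e⁻¹ := by
        rw [← Measure.isAddLeftInvariant_eq_smul]
    _ = (ρ.withDensity e).addHaarScalarFactor volume • expMeasure := by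
        rw [expMeasure, ← hinv]
        exact withDensity_smul_measure _ _

end ExpMeasure

section CellCoordinates

variable {m : Measure SL2R}

theorem measurePreserving_comap_cell {f : SL2R ≃ₜ SL2R} (hf : MeasurePreserving f m m)
    {F : ℝ × ℝ × ℝ → ℝ × ℝ × ℝ} (hF : Measurable F) (hFs : Function.Surjective F)
    (h : ∀ q, cell (F q) = f (cell q)) :
    MeasurePreserving F (m.comap cell) (m.comap cell) := by
  have hcell := isOpenEmbedding_cell.measurableEmbedding
  refine ⟨hF, Measure.ext fun A hA => ?_⟩
  have himage : f '' (cell '' (F ⁻¹' A)) = cell '' A := by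
    rw [← image_comp, show f ∘ cell = cell ∘ F from (funext h).symm, image_comp,
      image_preimage_eq A hFs]
  rw [Measure.map_apply hF hA, hcell.comap_apply, hcell.comap_apply,
    ← hf.measure_preimage (hcell.measurableSet_image.2 hA).nullMeasurableSet, ← himage,
    f.injective.preimage_image]

instance [IsFiniteMeasureOnCompacts m] : IsFiniteMeasureOnCompacts (m.comap cell) where
  lt_top_of_isCompact C hC := by
    rw [isOpenEmbedding_cell.measurableEmbedding.comap_apply]
    exact (hC.image continuous_cell).measure_lt_top

variable [m.IsHaarMeasure]

theorem measurePreserving_comap_cell_add_fst (u : ℝ) :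
    MeasurePreserving (fun q : ℝ × ℝ × ℝ => (q.1 + u, q.2)) (m.comap cell) (m.comap cell) :=
  measurePreserving_comap_cell (f := Homeomorph.mulRight (lowerMatrix (-u)))
    (measurePreserving_mul_right m _) (by fun_prop) (fun q => ⟨(q.1 - u, q.2), by simp⟩)
    fun q => by simp only [cell, neg_add, lowerMatrix_add, mul_assoc, Homeomorph.coe_mulRight]

theorem measurePreserving_comap_cell_add_snd (u : ℝ) :
    MeasurePreserving (Prod.map id fun p : ℝ × ℝ => (p.1 + u, p.2))
      (m.comap cell) (m.comap cell) :=
  measurePreserving_comap_cell (f := Homeomorph.mulLeft (upperMatrix u))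
    (measurePreserving_mul_left m _) (by fun_prop) (fun q => ⟨(q.1, q.2.1 - u, q.2.2), by simp⟩)
    fun q => by simp [cell, add_comm _ u, upperMatrix_add, mul_assoc]

theorem measurePreserving_comap_cell_scale (u : ℝ) :
    MeasurePreserving (Prod.map id fun p : ℝ × ℝ => (Real.exp u * p.1, u + p.2))
      (m.comap cell) (m.comap cell) :=
  measurePreserving_comap_cell (f := Homeomorph.mulLeft (diagMatrix u))
    (measurePreserving_mul_left m _) (by fun_prop)
    (fun q => ⟨(q.1, (Real.exp u)⁻¹ * q.2.1, q.2.2 - u), by simp⟩)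
    fun q => by simp [cell, diagMatrix_add, ← mul_assoc, diagMatrix_mul_upperMatrix]

theorem map_add_left_unitSlice {ρ : Measure (ℝ × ℝ)} [SFinite ρ]
    (hshift : ∀ u : ℝ, MeasurePreserving (fun p : ℝ × ℝ => (p.1 + u, p.2)) ρ ρ)
    (hscale : ∀ u : ℝ, MeasurePreserving (fun p : ℝ × ℝ => (Real.exp u * p.1, u + p.2)) ρ ρ)
    (u : ℝ) : (unitSlice ρ).map (u + ·) = ENNReal.ofReal (Real.exp u) • unitSlice ρ := by
  ext T hT
  have hpre : (fun p : ℝ × ℝ => (Real.exp u * p.1, u + p.2)) ⁻¹' (Ico 0 (Real.exp u) ×ˢ T) =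
      Ico 0 1 ×ˢ ((u + ·) ⁻¹' T) := by
    ext p
    simp [Real.exp_pos u]
  rw [Measure.map_apply (by fun_prop) hT, unitSlice_apply ρ (measurable_const_add u hT), ← hpre,
    (hscale u).measure_preimage (measurableSet_Ico.prod hT).nullMeasurableSet,
    ← volume_prod_unitSlice hshift, Measure.prod_prod]
  simp [volume_prod_unitSlice hshift]

theorem exists_comap_cell_eq (m : Measure SL2R) [m.IsHaarMeasure] :
    ∃ k : NNReal, m.comap cell = k • (volume : Measure ℝ).prod
      ((volume : Measure ℝ).prod expMeasure) := by
  have hshift (u : ℝ) : MeasurePreserving (fun p : ℝ × ℝ => (p.1 + u, p.2))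
      (unitSlice (m.comap cell)) (unitSlice (m.comap cell)) :=
    measurePreserving_unitSlice (by fun_prop) (measurePreserving_comap_cell_add_snd u)
  have hscale (u : ℝ) : MeasurePreserving (fun p : ℝ × ℝ => (Real.exp u * p.1, u + p.2))
      (unitSlice (m.comap cell)) (unitSlice (m.comap cell)) :=
    measurePreserving_unitSlice (by fun_prop) (measurePreserving_comap_cell_scale u)
  obtain ⟨k, hk⟩ := exists_eq_smul_expMeasure (map_add_left_unitSlice hshift hscale)
  refine ⟨k, ?_⟩
  rw [← volume_prod_unitSlice (ρ := m.comap cell) measurePreserving_comap_cell_add_fst,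
    ← volume_prod_unitSlice hshift, hk, Measure.prod_smul_right, Measure.prod_smul_right]

end CellCoordinates

/-! ### The row vectors of a cusp -/

/-- The lower rows of the matrices in `a⁻¹ Γ`. If `Γ a` lies on the closed horocycle of length one
around a cusp, these row vectors parametrise the lifts to `SL(2, ℝ)` of the geodesics that end in
this cusp. -/
def cuspRows (Γ : Subgroup SL2R) (a : SL2R) : Set (Fin 2 → ℝ) :=
  {p | ∃ γ ∈ Γ, (a⁻¹ * γ) 1 = p}

/-- The unipotent matrix fixing the row vector `p`. -/
def rowUnipotent (p : Fin 2 → ℝ) : SL2R :=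
  ⟨!![1 + p 0 * p 1, p 1 ^ 2; -p 0 ^ 2, 1 - p 0 * p 1], by rw [Matrix.det_fin_two_of]; ring⟩

@[simp] theorem coe_rowUnipotent (p : Fin 2 → ℝ) :
    (rowUnipotent p : Matrix (Fin 2) (Fin 2) ℝ) =
      !![1 + p 0 * p 1, p 1 ^ 2; -p 0 ^ 2, 1 - p 0 * p 1] := rfl

section Rows

variable {Γ : Subgroup SL2R} {a : SL2R} {p : Fin 2 → ℝ}

theorem vecMul_mem_cuspRows (hp : p ∈ cuspRows Γ a) {γ : SL2R} (hγ : γ ∈ Γ) :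
    p ᵥ* γ.1 ∈ cuspRows Γ a := by
  obtain ⟨γ', h', rfl⟩ := hp
  exact ⟨γ' * γ, Γ.mul_mem h' hγ, by rw [← mul_assoc]; rfl⟩

theorem neg_mem_cuspRows (hneg : (-1 : SL2R) ∈ Γ) (hp : p ∈ cuspRows Γ a) :
    -p ∈ cuspRows Γ a := by
  simpa [Matrix.vecMul_neg] using vecMul_mem_cuspRows hp hneg

theorem countable_cuspRows (Γ : Subgroup SL2R) [Countable Γ] (a : SL2R) :
    (cuspRows Γ a).Countable :=
  (countable_range fun γ : Γ => (a⁻¹ * γ.1) 1).mono <| by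
    rintro _ ⟨γ, hγ, rfl⟩
    exact ⟨⟨γ, hγ⟩, rfl⟩

theorem continuous_rowUnipotent : Continuous rowUnipotent :=
  Continuous.subtype_mk (by fun_prop) _

theorem finite_rowUnipotent_fiber (M : SL2R) : (rowUnipotent ⁻¹' {M}).Finite := by
  have hsq (c : ℝ) : {x : ℝ | x ^ 2 = c}.Finite := by
    refine (toFinite {√c, -√c}).subset ?_
    rintro x rfl
    rw [Real.sqrt_sq_eq_abs]
    rcases abs_choice x with h | h <;> simp [h]
  refine (Finite.pi' fun i => hsq (![-M 1 0, M 0 1] i)).subset ?_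
  rintro p rfl i
  fin_cases i <;> simp [rowUnipotent]

theorem upperMatrix_one_mul (A : SL2R) : upperMatrix 1 * A = A * rowUnipotent (A 1) := by
  have h := A.det_entries
  ext i j
  fin_cases i <;> fin_cases j <;>
    simp only [SL2R.mul_entry, coe_rowUnipotent, coe_upperMatrix, Fin.zero_eta, Fin.mk_one,
      Matrix.of_apply, Matrix.cons_val', Matrix.cons_val_zero, Matrix.cons_val_one,
      Matrix.cons_val_fin_one]
  · linear_combination -A 1 0 * h
  · linear_combination -A 1 1 * h
  · ring
  · ring

theorem finite_cuspRows_inter [DiscreteTopology Γ] (ha : a * upperMatrix 1 * a⁻¹ ∈ Γ)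
    {C : Set (Fin 2 → ℝ)} (hC : IsCompact C) : (cuspRows Γ a ∩ C).Finite := by
  have hfin : ((Γ : Set SL2R) ∩ rowUnipotent '' C).Finite := by
    have h := (Γ.tendsto_coe_cofinite_of_discrete
      (isDiscrete_iff_discreteTopology.mpr inferInstance)).eventually
        (hC.image continuous_rowUnipotent).compl_mem_cocompact
    refine (h.image Subtype.val).subset ?_
    rintro γ ⟨hγ, hγC⟩
    exact ⟨⟨γ, hγ⟩, not_not.2 hγC, rfl⟩
  refine (hfin.preimage' fun M _ => finite_rowUnipotent_fiber M).subset ?_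
  rintro _ ⟨⟨γ, hγ, rfl⟩, hpC⟩
  refine ⟨?_, mem_image_of_mem _ hpC⟩
  have hconj : rowUnipotent ((a⁻¹ * γ) 1) = γ⁻¹ * (a * upperMatrix 1 * a⁻¹) * γ := by
    rw [← inv_mul_eq_iff_eq_mul.2 (upperMatrix_one_mul (a⁻¹ * γ))]
    group
  rw [hconj]
  exact Γ.mul_mem (Γ.mul_mem (Γ.inv_mem hγ) ha) hγ

theorem finite_cuspRows_vecMul_mem [DiscreteTopology Γ] (ha : a * upperMatrix 1 * a⁻¹ ∈ Γ)
    {C : Set SL2R} (hC : IsCompact C) {B : Set (Fin 2 → ℝ)} (hB : IsCompact B) :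
    {p ∈ cuspRows Γ a | ∃ h ∈ C, p ᵥ* h.1 ∈ B}.Finite := by
  have hinv : Continuous fun q : (Fin 2 → ℝ) × SL2R => q.2⁻¹ := by fun_prop
  have hcont : Continuous fun q : (Fin 2 → ℝ) × SL2R => q.1 ᵥ* (q.2⁻¹).1 :=
    continuous_fst.matrix_vecMul (continuous_subtype_val.comp hinv)
  refine (finite_cuspRows_inter ha ((hB.prod hC).image hcont)).subset ?_
  rintro p ⟨hp, h, hhC, hpB⟩
  refine ⟨hp, (p ᵥ* h.1, h), ⟨hpB, hhC⟩, ?_⟩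
  dsimp only
  rw [Matrix.vecMul_vecMul, ← Matrix.SpecialLinearGroup.coe_mul, mul_inv_cancel,
    Matrix.SpecialLinearGroup.coe_one, Matrix.vecMul_one]

end Rows

/-! ### Hits of the section in terms of row vectors -/

/-- The row vectors `v` such that `v ᵥ* lowerMatrix (ε * s) = (0, y)` with `0 < y ≤ δ` for some time
`s ∈ (0, r]`: these are the rows that produce a hit up to time `r`. -/
def hitTriangle (ε δ : ℝ) (r : NNReal) : Set (Fin 2 → ℝ) :=
  {v | 0 < ε * v 0 ∧ ε * v 0 ≤ r * v 1 ∧ v 1 ≤ δ}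

theorem hitTriangle_subset_Icc {ε : ℝ} (hε : ε * ε = 1) (δ : ℝ) (r : NNReal) :
    hitTriangle ε δ r ⊆ Icc ![-(r * δ), 0] ![r * δ, δ] := by
  rintro v ⟨h0, hle, hδ⟩
  have h1 : 0 < v 1 := pos_of_mul_pos_right (h0.trans_le hle) r.2
  have hrδ : r * v 1 ≤ r * δ := mul_le_mul_of_nonneg_left hδ r.2
  rcases mul_self_eq_one_iff.1 hε with rfl | rfl <;>
    exact ⟨Fin.forall_fin_two.2 ⟨by simp; linarith, h1.le⟩,
      Fin.forall_fin_two.2 ⟨by simp; linarith, hδ⟩⟩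

section Hits

variable (Γ : Subgroup SL2R) {K : ℕ} (g : Fin K → SL2R) (σ : Fin K → ℝ)

theorem unstableFlow_mem_multiSection_iff (h : SL2R) (r : ℝ) :
    unstableFlow Γ r (toCoset Γ h) ∈ multiSection Γ g σ 0 ↔
      ∃ κ, ∃ p ∈ cuspRows Γ (g κ), (p ᵥ* h.1) 0 = r * (p ᵥ* h.1) 1 ∧
        0 < (p ᵥ* h.1) 1 ∧ (p ᵥ* h.1) 1 ≤ Real.exp (-σ κ / 2) := by
  simp only [multiSection, cuspSection, cuspHorocycle, mem_iUnion, mem_image, mem_range, mem_Ici,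
    exists_prop, exists_exists_eq_and, stableFlow_toCoset, geodesicFlow_toCoset,
    unstableFlow_toCoset, add_zero, toCoset_eq_iff]
  refine exists_congr fun κ => ⟨?_, ?_⟩
  · rintro ⟨t, ht, s, γ, hγ, e⟩
    have hA : (g κ)⁻¹ * γ⁻¹ * h = cell (r, s, t) := by
      rw [cell, lowerMatrix_neg, eq_mul_inv_iff_mul_eq, mul_assoc, ← e]
      group
    refine ⟨_, ⟨γ⁻¹, Γ.inv_mem hγ, rfl⟩, ?_⟩
    change ((g κ)⁻¹ * γ⁻¹ * h) 1 0 = r * ((g κ)⁻¹ * γ⁻¹ * h) 1 1 ∧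
      0 < ((g κ)⁻¹ * γ⁻¹ * h) 1 1 ∧ ((g κ)⁻¹ * γ⁻¹ * h) 1 1 ≤ _
    rw [hA, cell_10, cell_11]
    exact ⟨rfl, Real.exp_pos _, Real.exp_le_exp.2 (by linarith)⟩
  · rintro ⟨_, ⟨γ, hγ, rfl⟩, h10, hpos, hle⟩
    set A := (g κ)⁻¹ * γ * h with hA
    change A 1 0 = r * A 1 1 at h10
    change 0 < A 1 1 at hpos
    change A 1 1 ≤ _ at hle
    refine ⟨-2 * Real.log (A 1 1), ?_, A 0 1 / A 1 1, γ⁻¹, Γ.inv_mem hγ, ?_⟩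
    · have := (Real.log_le_iff_le_exp hpos).2 hle
      linarith
    · have hcell := cell_cellCoord hpos
      rw [cellCoord, h10, mul_div_cancel_right₀ _ hpos.ne', cell, lowerMatrix_neg,
        mul_inv_eq_iff_eq_mul] at hcell
      rw [mul_assoc (g κ), hcell, hA]
      group

/-- A lift to `SL(2, ℝ)` of the point of the section with parameter `w`. -/
def sectionPoint (w : ℝ × ℝ × Fin K) : SL2R :=
  g w.2.2 * upperMatrix w.1 * diagMatrix w.2.1

theorem param_zero (w : ℝ × ℝ × Fin K) : param Γ g 0 w = toCoset Γ (sectionPoint g w) := by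
  simp [param, sectionPoint]

theorem continuous_sectionPoint : Continuous (sectionPoint g) := by
  have : Continuous g := continuous_of_discreteTopology
  unfold sectionPoint
  fun_prop

theorem vecMul_sectionPoint_zero (p : Fin 2 → ℝ) (w : ℝ × ℝ × Fin K) :
    (p ᵥ* (sectionPoint g w).1) 0 = (p ᵥ* (g w.2.2).1) 0 * Real.exp (w.2.1 / 2) := by
  rw [sectionPoint, mul_assoc, Matrix.SpecialLinearGroup.coe_mul, ← Matrix.vecMul_vecMul]
  simp [Matrix.vecMul_eq_sum]

/-- The set of positive times at which the orbit `r ↦ h⁺_{ε r} (x)` is in the section. -/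
def hitSet (ε : ℝ) (x : CosetSpace Γ) : Set ℝ :=
  {r | 0 < r ∧ unstableFlow Γ (ε * r) x ∈ multiSection Γ g σ 0}

/-- The first hitting time for the orbit `r ↦ h⁺_{ε r} (x)`, so that `ε = 1` and `ε = -1` treat
forward and backward hits together. -/
def firstHit (ε : ℝ) (x : CosetSpace Γ) : ENNReal :=
  ⨅ r ∈ hitSet Γ g σ ε x, ENNReal.ofReal r

theorem hittingTime_eq_firstHit (x : CosetSpace Γ) :
    hittingTime Γ g σ 0 x = firstHit Γ g σ 1 x := by
  simp [hittingTime, firstHit, hitSet]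

theorem backwardHittingTime_eq_firstHit (x : CosetSpace Γ) :
    backwardHittingTime Γ g σ 0 x = firstHit Γ g σ (-1) x := by
  simp [backwardHittingTime, firstHit, hitSet]

variable {Γ g σ}

theorem IsCuspSystem.conj_upperMatrix_mem_iff (hg : IsCuspSystem Γ g) (κ : Fin K) (s : ℝ) :
    g κ * upperMatrix s * (g κ)⁻¹ ∈ Γ ↔ ∃ n : ℤ, s = n := by
  rw [← hg.length_one κ s, stableFlow_toCoset, eq_comm, toCoset_eq_iff]
  constructor
  · intro h
    exact ⟨_, h, by simp⟩
  · rintro ⟨γ, hγ, h⟩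
    rw [← h]
    simpa using hγ

theorem IsCuspSystem.conj_upperMatrix_one_mem (hg : IsCuspSystem Γ g) (κ : Fin K) :
    g κ * upperMatrix 1 * (g κ)⁻¹ ∈ Γ :=
  (hg.conj_upperMatrix_mem_iff κ 1).2 ⟨1, by simp⟩

theorem firstHit_eq_of_isLeast {ε r : ℝ} {x : CosetSpace Γ} (h : IsLeast (hitSet Γ g σ ε x) r) :
    firstHit Γ g σ ε x = ENNReal.ofReal r :=
  le_antisymm (iInf₂_le r h.1) (le_iInf₂ fun _ h' => ENNReal.ofReal_le_ofReal (h.2 h'))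

theorem isClosed_setOf_vecMul_sectionPoint_mem_hitTriangle (p : Fin 2 → ℝ) (ε δ : ℝ)
    (r : NNReal) :
    IsClosed {w | p ᵥ* (sectionPoint g w).1 ∈ hitTriangle ε δ r} := by
  have hv (i : Fin 2) : Continuous fun w => (p ᵥ* (sectionPoint g w).1) i :=
    (continuous_apply i).comp (continuous_const.matrix_vecMul
      (continuous_subtype_val.comp (continuous_sectionPoint g)))
  -- Along a sheet, the sign of `v 0` is constant.
  have hpos : IsClosed {w : ℝ × ℝ × Fin K | 0 < ε * (p ᵥ* (sectionPoint g w).1) 0} := by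
    simp only [vecMul_sectionPoint_zero, ← mul_assoc, mul_pos_iff_of_pos_right (Real.exp_pos _)]
    exact (isClosed_discrete {κ | 0 < ε * (p ᵥ* (g κ).1) 0}).preimage
      (continuous_snd.comp continuous_snd)
  exact hpos.inter ((isClosed_le (continuous_const.mul (hv 0)) (continuous_const.mul (hv 1))).inter
    (isClosed_le (hv 1) continuous_const))

section Sign

variable {ε : ℝ} (hε : ε * ε = 1)
include hε

theorem mem_hitSet_toCoset_iff {h : SL2R} {r : ℝ} :
    r ∈ hitSet Γ g σ ε (toCoset Γ h) ↔ 0 < r ∧ ∃ κ, ∃ p ∈ cuspRows Γ (g κ),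
      ε * (p ᵥ* h.1) 0 = r * (p ᵥ* h.1) 1 ∧
        0 < (p ᵥ* h.1) 1 ∧ (p ᵥ* h.1) 1 ≤ Real.exp (-σ κ / 2) := by
  rw [hitSet, mem_ofPred_eq, unstableFlow_mem_multiSection_iff]
  have (x y : ℝ) : x = ε * r * y ↔ ε * x = r * y :=
    ⟨fun h => by linear_combination ε * h + r * y * hε,
      fun h => by linear_combination ε * h - x * hε⟩
  simp only [this]

theorem exists_vecMul_mem_hitTriangle {h : SL2R} {s : ℝ} {r : NNReal}
    (hs : s ∈ hitSet Γ g σ ε (toCoset Γ h)) (hsr : s ≤ r) :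
    ∃ κ, ∃ p ∈ cuspRows Γ (g κ), p ᵥ* h.1 ∈ hitTriangle ε (Real.exp (-σ κ / 2)) r ∧
      ε * (p ᵥ* h.1) 0 / (p ᵥ* h.1) 1 = s := by
  obtain ⟨hs0, κ, p, hp, heq, hpos, hle⟩ := (mem_hitSet_toCoset_iff hε).1 hs
  refine ⟨κ, p, hp, ⟨heq ▸ mul_pos hs0 hpos, ?_, hle⟩,
    by rw [heq, mul_div_cancel_right₀ _ hpos.ne']⟩
  rw [heq]
  gcongr

theorem exists_mem_hitSet_le {h : SL2R} {r : NNReal} {κ : Fin K} {p : Fin 2 → ℝ}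
    (hp : p ∈ cuspRows Γ (g κ)) (hph : p ᵥ* h.1 ∈ hitTriangle ε (Real.exp (-σ κ / 2)) r) :
    ∃ s ∈ hitSet Γ g σ ε (toCoset Γ h), s ≤ r := by
  obtain ⟨h0, hle, hδ⟩ := hph
  have hpos : 0 < (p ᵥ* h.1) 1 := pos_of_mul_pos_right (h0.trans_le hle) r.2
  exact ⟨ε * (p ᵥ* h.1) 0 / (p ᵥ* h.1) 1, (mem_hitSet_toCoset_iff hε).2 ⟨div_pos h0 hpos, κ, p, hp,
    (div_mul_cancel₀ _ hpos.ne').symm, hpos, hδ⟩, (div_le_iff₀ hpos).2 hle⟩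

variable [DiscreteTopology Γ]

theorem IsCuspSystem.finite_cuspRows_hitTriangle (hg : IsCuspSystem Γ g) (κ : Fin K)
    {C : Set SL2R} (hC : IsCompact C) (δ : ℝ) (r : NNReal) :
    {p ∈ cuspRows Γ (g κ) | ∃ h ∈ C, p ᵥ* h.1 ∈ hitTriangle ε δ r}.Finite :=
  (finite_cuspRows_vecMul_mem (hg.conj_upperMatrix_one_mem κ) hC isCompact_Icc).subset
    fun _ ⟨hp, h, hhC, hph⟩ => ⟨hp, h, hhC, hitTriangle_subset_Icc hε δ r hph⟩

theorem IsCuspSystem.finite_hitSet_inter_Iic (hg : IsCuspSystem Γ g) (x : CosetSpace Γ)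
    (r : NNReal) : (hitSet Γ g σ ε x ∩ Iic (r : ℝ)).Finite := by
  obtain ⟨h, rfl⟩ := toCoset_surjective Γ x
  refine (finite_iUnion fun κ => (hg.finite_cuspRows_hitTriangle hε κ (isCompact_singleton (x := h))
    (Real.exp (-σ κ / 2)) r).image fun p => ε * (p ᵥ* h.1) 0 / (p ᵥ* h.1) 1).subset ?_
  rintro s ⟨hs, hsr⟩
  obtain ⟨κ, p, hp, hph, hps⟩ := exists_vecMul_mem_hitTriangle hε hs hsr
  exact mem_iUnion.2 ⟨κ, p, ⟨hp, h, rfl, hph⟩, hps⟩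

theorem IsCuspSystem.exists_isLeast_hitSet (hg : IsCuspSystem Γ g) {x : CosetSpace Γ}
    (hx : (hitSet Γ g σ ε x).Nonempty) : ∃ r, IsLeast (hitSet Γ g σ ε x) r := by
  obtain ⟨r, hr⟩ := hx
  lift r to NNReal using hr.1.le
  obtain ⟨s, ⟨hs, hsr⟩, hmin⟩ :=
    exists_min_image _ id (hg.finite_hitSet_inter_Iic hε x r) ⟨r, hr, le_refl (r : ℝ)⟩
  refine ⟨s, hs, fun s' hs' => ?_⟩
  rcases le_total s' r with h | h
  · exact hmin s' ⟨hs', h⟩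
  · exact hsr.trans h

theorem IsCuspSystem.isLeast_toReal_firstHit (hg : IsCuspSystem Γ g) {x : CosetSpace Γ}
    (hx : firstHit Γ g σ ε x ≠ ⊤) : IsLeast (hitSet Γ g σ ε x) (firstHit Γ g σ ε x).toReal := by
  obtain ⟨r, hr⟩ := hg.exists_isLeast_hitSet hε (x := x) (σ := σ) <| by
    by_contra h
    exact hx (by simp [firstHit, not_nonempty_iff_eq_empty.1 h])
  rwa [firstHit_eq_of_isLeast hr, ENNReal.toReal_ofReal hr.1.1.le]

theorem IsCuspSystem.firstHit_le_iff (hg : IsCuspSystem Γ g) {h : SL2R} {r : NNReal} :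
    firstHit Γ g σ ε (toCoset Γ h) ≤ r ↔ ∃ κ, ∃ p ∈ cuspRows Γ (g κ),
      p ᵥ* h.1 ∈ hitTriangle ε (Real.exp (-σ κ / 2)) r := by
  constructor
  · intro hle
    have hmem := (hg.isLeast_toReal_firstHit hε (hle.trans_lt ENNReal.coe_lt_top).ne).1
    obtain ⟨κ, p, hp, hph, -⟩ := exists_vecMul_mem_hitTriangle hε hmem
      (ENNReal.toReal_mono ENNReal.coe_ne_top hle)
    exact ⟨κ, p, hp, hph⟩
  · rintro ⟨κ, p, hp, hph⟩
    obtain ⟨s, hs, hsr⟩ := exists_mem_hitSet_le hε hp hph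
    exact (iInf₂_le s hs).trans (ENNReal.ofReal_le_of_le_toReal hsr)

theorem IsCuspSystem.lowerSemicontinuous_firstHit_param (hg : IsCuspSystem Γ g) :
    LowerSemicontinuous fun w => firstHit Γ g σ ε (param Γ g 0 w) := by
  rw [lowerSemicontinuous_iff_isClosed_preimage]
  rintro (_ | r)
  · simp
  have hunion : (fun w => firstHit Γ g σ ε (param Γ g 0 w)) ⁻¹' Iic ↑r =
      ⋃ κ, ⋃ p : cuspRows Γ (g κ), {w | p.1 ᵥ* (sectionPoint g w).1 ∈
        hitTriangle ε (Real.exp (-σ κ / 2)) r} := by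
    ext w
    simp only [mem_preimage, mem_Iic, param_zero, hg.firstHit_le_iff hε, mem_iUnion,
      mem_ofPred_eq, Subtype.exists, exists_prop]
  refine hunion ▸ isClosed_iUnion_of_finite fun κ => LocallyFinite.isClosed_iUnion ?_ fun p =>
    isClosed_setOf_vecMul_sectionPoint_mem_hitTriangle _ _ _ _
  intro w
  obtain ⟨N, hN, hw⟩ := exists_compact_mem_nhds w
  refine ⟨N, hw, ((hg.finite_cuspRows_hitTriangle hε κ (hN.image (continuous_sectionPoint g))
    (Real.exp (-σ κ / 2)) r).preimage Subtype.val_injective.injOn).subset ?_⟩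
  rintro p ⟨w', hw', hwN⟩
  exact ⟨p.2, sectionPoint g w', mem_image_of_mem _ hwN, hw'⟩

end Sign

end Hits

/-! ### Almost every orbit hits the section -/

theorem countable_of_discreteTopology (Γ : Subgroup SL2R) [DiscreteTopology Γ] : Countable Γ :=
  TopologicalSpace.separableSpace_iff_countable.1 inferInstance

theorem measure_preimage_mul_right_inter {G : Type*} [Group G] [MeasurableSpace G]
    [MeasurableMul G] {Γ : Subgroup G} [Countable Γ] {m : Measure G} [m.IsMulLeftInvariant]
    [m.IsMulRightInvariant] {F : Set G} (hF : IsFundamentalDomain Γ F m) (a : G) {S : Set G}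
    (hS : MeasurableSet S) (hinv : ∀ γ ∈ Γ, (γ * ·) ⁻¹' S = S) :
    m ((· * a) ⁻¹' S ∩ F) = m (S ∩ F) := by
  have hF' : IsFundamentalDomain Γ ((· * a⁻¹) ⁻¹' F) m :=
    hF.preimage_of_equiv (measurePreserving_mul_right m a⁻¹).quasiMeasurePreserving
      (e := id) Function.bijective_id fun γ h => mul_assoc (γ : G) h a⁻¹
  have hpre : (· * a) ⁻¹' S ∩ F = (· * a) ⁻¹' (S ∩ (· * a⁻¹) ⁻¹' F) := by
    ext h
    simp
  rw [hpre, (measurePreserving_mul_right m a).measure_preimage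
    (hS.nullMeasurableSet.inter hF'.nullMeasurableSet)]
  exact (hF.measure_set_eq hF' hS fun γ => hinv γ γ.2).symm

theorem measure_lower_right_entry_eq_zero (m : Measure SL2R) [m.IsHaarMeasure] (a : SL2R) :
    m {h : SL2R | (a * h) 1 1 = 0} = 0 := by
  have hZ : MeasurableSet {h : SL2R | h 1 1 = 0} :=
    (isClosed_eq (by fun_prop) continuous_const).measurableSet
  -- Uncountably many disjoint translates have the same measure, which is therefore zero.
  have hdisj : Pairwise (Function.onFun Disjoint
      fun u : ℝ => (· * upperMatrix u) ⁻¹' {h : SL2R | h 1 1 = 0}) := by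
    refine fun u v huv => disjoint_left.2 fun h hu hv => huv ?_
    simp only [mem_preimage, mem_ofPred_eq, SL2R.mul_entry, coe_upperMatrix, Matrix.of_apply,
      Matrix.cons_val', Matrix.cons_val_zero, Matrix.cons_val_one, Matrix.cons_val_fin_one,
      mul_one] at hu hv
    have hne : h 1 0 ≠ 0 := by
      intro h10
      have hdet := h.det_entries
      rw [h10, zero_mul, zero_add] at hu
      simp [h10, hu] at hdet
    exact mul_left_cancel₀ hne (by linarith)
  have hcount := Measure.countable_meas_pos_of_disjoint_iUnion (μ := m)
    (fun u => measurable_mul_const (upperMatrix u) hZ) hdisj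
  simp only [fun u => (measurePreserving_mul_right m (upperMatrix u)).measure_preimage
    hZ.nullMeasurableSet] at hcount
  have h0 : m {h : SL2R | h 1 1 = 0} = 0 := by
    by_contra hne
    simp only [pos_iff_ne_zero.2 hne, ofPred_true] at hcount
    exact Cardinal.not_countable_real hcount
  exact (measure_preimage_mul m a _).trans h0

theorem vecMul_diagMatrix (v : Fin 2 → ℝ) (t : ℝ) :
    v ᵥ* (diagMatrix t).1 = ![v 0 * Real.exp (t / 2), v 1 * Real.exp (-t / 2)] := by
  ext i
  fin_cases i <;> simp [Matrix.vecMul_eq_sum]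

theorem vecMul_lowerMatrix (v : Fin 2 → ℝ) (s : ℝ) :
    v ᵥ* (lowerMatrix s).1 = ![v 0 - s * v 1, v 1] := by
  ext i
  fin_cases i <;> simp [Matrix.vecMul_eq_sum]
  ring

/-- The set of all `h` such that no vector `p h`, where `p` is a row of the cusp, lies in `T`. -/
def avoiding (Γ : Subgroup SL2R) (a : SL2R) (T : Set (Fin 2 → ℝ)) : Set SL2R :=
  {h | ∀ p ∈ cuspRows Γ a, p ᵥ* h.1 ∉ T}

section Avoiding

variable {Γ : Subgroup SL2R} {a : SL2R} {T : Set (Fin 2 → ℝ)}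

theorem measurableSet_avoiding [Countable Γ] (hT : MeasurableSet T) :
    MeasurableSet (avoiding Γ a T) := by
  have hbInter : avoiding Γ a T = ⋂ p ∈ cuspRows Γ a, {h : SL2R | p ᵥ* h.1 ∈ Tᶜ} := by
    ext h
    simp [avoiding]
  rw [hbInter]
  have hcont (p : Fin 2 → ℝ) : Continuous fun h : SL2R => p ᵥ* h.1 :=
    continuous_const.matrix_vecMul continuous_subtype_val
  exact .biInter (countable_cuspRows Γ a) fun p _ => (hcont p).measurable hT.compl

theorem preimage_mul_left_avoiding {γ : SL2R} (hγ : γ ∈ Γ) :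
    (γ * ·) ⁻¹' avoiding Γ a T = avoiding Γ a T := by
  have key {γ h : SL2R} (hγ : γ ∈ Γ) (hh : h ∈ avoiding Γ a T) : γ * h ∈ avoiding Γ a T := by
    intro p hp
    rw [Matrix.SpecialLinearGroup.coe_mul, ← Matrix.vecMul_vecMul]
    exact hh _ (vecMul_mem_cuspRows hp hγ)
  refine Subset.antisymm (fun h hh => ?_) fun h hh => key hγ hh
  simpa using key (Γ.inv_mem hγ) hh

theorem measure_avoiding_upper_half_plane_eq_zero (m : Measure SL2R) [m.IsHaarMeasure]
    (hneg : (-1 : SL2R) ∈ Γ) : m (avoiding Γ a {v | 0 < v 1}) = 0 := by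
  refine measure_mono_null ?_ (measure_lower_right_entry_eq_zero m a⁻¹)
  intro h hh
  have hp : a⁻¹ 1 ∈ cuspRows Γ a := ⟨1, Γ.one_mem, by rw [mul_one]⟩
  have hle : (a⁻¹ * h) 1 1 ≤ 0 := not_lt.1 (hh _ hp)
  have hge : -(a⁻¹ * h) 1 1 ≤ 0 := not_lt.1 fun hpos =>
    hh _ (neg_mem_cuspRows hneg hp) (by rwa [Matrix.neg_vecMul])
  exact hle.antisymm (neg_nonpos.1 hge)

variable [Countable Γ] {m : Measure SL2R} [m.IsHaarMeasure] {F : Set SL2R}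
  (hF : IsFundamentalDomain Γ F m)
include hF

theorem measure_avoiding_eq_zero_of_subset_iUnion (hmF : m F ≠ ⊤) (hT : MeasurableSet T)
    {b : ℕ → SL2R} (hmono : Monotone fun n => {v | v ᵥ* (b n).1 ∈ T}) {T' : Set (Fin 2 → ℝ)}
    (hT' : T' ⊆ ⋃ n, {v | v ᵥ* (b n).1 ∈ T}) (h0 : m (avoiding Γ a T' ∩ F) = 0) :
    m (avoiding Γ a T ∩ F) = 0 := by
  let S (n : ℕ) : Set SL2R := (· * b n) ⁻¹' avoiding Γ a T
  have hS (n : ℕ) : m (S n ∩ F) = m (avoiding Γ a T ∩ F) :=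
    measure_preimage_mul_right_inter hF (b n) (measurableSet_avoiding hT)
      fun γ hγ => preimage_mul_left_avoiding hγ
  have hmem {n : ℕ} {h : SL2R} :
      h ∈ S n ↔ ∀ p ∈ cuspRows Γ a, p ᵥ* h.1 ∉ {v | v ᵥ* (b n).1 ∈ T} := by
    simp [S, avoiding, Matrix.vecMul_vecMul]
  have hlim := tendsto_measure_iInter_atTop (μ := m) (s := fun n => S n ∩ F)
    (fun n => (measurable_mul_const (b n) (measurableSet_avoiding hT)).nullMeasurableSet.inter
      hF.nullMeasurableSet)
    (fun i j hij => inter_subset_inter_left _ fun h hh => hmem.2 fun p hp hv =>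
      hmem.1 hh p hp (hmono hij hv))
    ⟨0, measure_ne_top_of_subset inter_subset_right hmF⟩
  have hzero : m (⋂ n, S n ∩ F) = 0 := by
    refine measure_mono_null (fun h hh => ?_) h0
    refine ⟨fun p hp hv => ?_, (mem_iInter.1 hh 0).2⟩
    obtain ⟨n, hn⟩ := mem_iUnion.1 (hT' hv)
    exact hmem.1 (mem_iInter.1 hh n).1 p hp hn
  simp only [Function.comp_def, hS, hzero] at hlim
  exact tendsto_nhds_unique tendsto_const_nhds hlim

theorem measure_avoiding_quadrant_eq_zero (hneg : (-1 : SL2R) ∈ Γ) (hmF : m F ≠ ⊤) {ε : ℝ}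
    (hε : ε * ε = 1) : m (avoiding Γ a {v | 0 < ε * v 0 ∧ 0 < v 1} ∩ F) = 0 := by
  have hmem (n : ℕ) : {v : Fin 2 → ℝ | v ᵥ* (lowerMatrix (-(ε * n))).1 ∈
      {v | 0 < ε * v 0 ∧ 0 < v 1}} = {v | 0 < ε * v 0 + n * v 1 ∧ 0 < v 1} := by
    ext v
    have : ε * (v 0 - -(ε * n) * v 1) = ε * v 0 + n * v 1 := by
      linear_combination n * v 1 * hε
    simp only [mem_ofPred_eq, vecMul_lowerMatrix, Matrix.cons_val_zero, Matrix.cons_val_one, this]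
  have h0 : Measurable fun v : Fin 2 → ℝ => ε * v 0 := by fun_prop
  refine measure_avoiding_eq_zero_of_subset_iUnion hF hmF (b := fun n => lowerMatrix (-(ε * n)))
    ?_ ?_ ?_ (measure_mono_null inter_subset_left
      (measure_avoiding_upper_half_plane_eq_zero m hneg))
  · exact (measurableSet_lt measurable_const h0).inter
      (measurableSet_lt measurable_const (measurable_pi_apply 1))
  · simp only [hmem]
    rintro i j hij v ⟨h0, h1⟩
    have : (i : ℝ) * v 1 ≤ j * v 1 := by gcongr
    exact ⟨by linarith, h1⟩
  · simp only [hmem]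
    intro v (h1 : 0 < v 1)
    obtain ⟨n, hn⟩ := exists_nat_gt (-(ε * v 0) / v 1)
    rw [div_lt_iff₀ h1] at hn
    exact mem_iUnion.2 ⟨n, by linarith, h1⟩

theorem measure_avoiding_strip_eq_zero (hneg : (-1 : SL2R) ∈ Γ) (hmF : m F ≠ ⊤) {ε : ℝ}
    (hε : ε * ε = 1) {δ : ℝ} (hδ : 0 < δ) :
    m (avoiding Γ a {v | 0 < ε * v 0 ∧ 0 < v 1 ∧ v 1 ≤ δ} ∩ F) = 0 := by
  have hmem (n : ℕ) : {v : Fin 2 → ℝ | v ᵥ* (diagMatrix (2 * n)).1 ∈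
      {v | 0 < ε * v 0 ∧ 0 < v 1 ∧ v 1 ≤ δ}} =
        {v | 0 < ε * v 0 ∧ 0 < v 1 ∧ v 1 ≤ δ * Real.exp n} := by
    ext v
    simp only [mem_ofPred_eq, vecMul_diagMatrix, Matrix.cons_val_zero, Matrix.cons_val_one, neg_div,
      mul_div_cancel_left₀ _ (two_ne_zero' ℝ), Real.exp_neg, ← div_eq_mul_inv,
      div_le_iff₀ (Real.exp_pos _), div_pos_iff_of_pos_right (Real.exp_pos _), ← mul_assoc,
      mul_pos_iff_of_pos_right (Real.exp_pos _)]
  have h0 : Measurable fun v : Fin 2 → ℝ => ε * v 0 := by fun_prop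
  refine measure_avoiding_eq_zero_of_subset_iUnion hF hmF (b := fun n => diagMatrix (2 * n))
    ?_ ?_ ?_ (measure_avoiding_quadrant_eq_zero hF hneg hmF hε)
  · exact (measurableSet_lt measurable_const h0).inter
      ((measurableSet_lt measurable_const (measurable_pi_apply 1)).inter
        (measurableSet_le (measurable_pi_apply 1) measurable_const))
  · simp only [hmem]
    rintro i j hij v ⟨h0, h1, hle⟩
    exact ⟨h0, h1, hle.trans (by gcongr)⟩
  · simp only [hmem]
    rintro v ⟨h0, h1⟩
    obtain ⟨n, hn⟩ := exists_nat_ge (v 1 / δ)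
    have hexp : (n : ℝ) ≤ Real.exp n := by linarith [Real.add_one_le_exp (n : ℝ)]
    exact mem_iUnion.2 ⟨n, h0, h1, (div_le_iff₀' hδ).1 (hn.trans hexp)⟩

end Avoiding

theorem liouville_apply {Γ : Subgroup SL2R} {m : Measure SL2R} {F : Set SL2R}
    {E : Set (CosetSpace Γ)} (hE : MeasurableSet E) :
    liouville Γ m F E = m (toCoset Γ ⁻¹' E ∩ F) := by
  have hπ := (continuous_toCoset Γ).measurable
  rw [liouville, Measure.map_apply hπ hE, Measure.restrict_apply (hπ hE)]

theorem ae_nonempty_hitSet {Γ : Subgroup SL2R} [DiscreteTopology Γ] (hneg : (-1 : SL2R) ∈ Γ)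
    {m : Measure SL2R} [m.IsHaarMeasure] {F : Set SL2R} (hF : IsFundamentalDomain Γ F m)
    (hmF : m F ≠ ⊤) {K : ℕ} (hK : 0 < K) (g : Fin K → SL2R) (σ : Fin K → ℝ)
    {ε : ℝ} (hε : ε * ε = 1) :
    ∀ᵐ h ∂(m.restrict F), (hitSet Γ g σ ε (toCoset Γ h)).Nonempty := by
  have := countable_of_discreteTopology Γ
  have h0 := measure_avoiding_strip_eq_zero (a := g ⟨0, hK⟩) hF hneg hmF hε
    (Real.exp_pos (-σ ⟨0, hK⟩ / 2))
  rw [← Measure.restrict_apply₀' hF.nullMeasurableSet] at h0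
  rw [ae_iff]
  refine measure_mono_null ?_ h0
  refine fun h hh p hp hv => hh ?_
  exact ⟨ε * (p ᵥ* h.1) 0 / (p ᵥ* h.1) 1, (mem_hitSet_toCoset_iff hε).2
    ⟨div_pos hv.1 hv.2.1, ⟨0, hK⟩, p, hp, (div_mul_cancel₀ _ hv.2.1.ne').symm, hv.2⟩⟩

/-! ### Injectivity of the parametrisation of the section -/

theorem conj_upperMatrix_of_upper_triangular (a τ b v : ℝ) :
    upperMatrix a * diagMatrix τ * upperMatrix b * upperMatrix v *
      (upperMatrix a * diagMatrix τ * upperMatrix b)⁻¹ = upperMatrix (Real.exp τ * v) := by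
  rw [mul_inv_eq_iff_eq_mul]
  simp only [mul_assoc, ← upperMatrix_add]
  rw [diagMatrix_mul_upperMatrix, diagMatrix_mul_upperMatrix]
  simp only [← mul_assoc, ← upperMatrix_add]
  ring_nf

theorem endpoint_mul_upperMatrix_mul_diagMatrix (a : SL2R) (s t : ℝ) :
    endpoint (a * upperMatrix s * diagMatrix t) = endpoint a := by
  simp only [endpoint, mul_assoc, map_mul, mul_smul]
  congr 1
  rw [← mul_smul, ← map_mul, OnePoint.smul_infty_eq_self_iff]
  change (upperMatrix s * diagMatrix t) 1 0 = 0
  simp [SL2R.mul_entry]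

section Param

variable {Γ : Subgroup SL2R} {K : ℕ} {g : Fin K → SL2R}

theorem IsCuspSystem.exists_exp_eq_intCast (hg : IsCuspSystem Γ g) {κ : Fin K} {a τ b : ℝ}
    (h : g κ * (upperMatrix a * diagMatrix τ * upperMatrix b) * (g κ)⁻¹ ∈ Γ) :
    ∃ n : ℤ, Real.exp τ = n := by
  rw [← mul_one (Real.exp τ), ← hg.conj_upperMatrix_mem_iff κ,
    ← conj_upperMatrix_of_upper_triangular a τ b]
  convert Γ.mul_mem (Γ.mul_mem h (hg.conj_upperMatrix_one_mem κ)) (Γ.inv_mem h) using 1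
  group

theorem IsCuspSystem.eq_zero_of_conj_mem (hg : IsCuspSystem Γ g) {κ : Fin K} {a τ b : ℝ}
    (h : g κ * (upperMatrix a * diagMatrix τ * upperMatrix b) * (g κ)⁻¹ ∈ Γ) : τ = 0 := by
  obtain ⟨n, hn⟩ := hg.exists_exp_eq_intCast h
  obtain ⟨n', hn'⟩ : ∃ n' : ℤ, Real.exp (-τ) = n' := by
    refine hg.exists_exp_eq_intCast (κ := κ) (a := -b) (b := -a) ?_
    convert Γ.inv_mem h using 1
    simp only [upperMatrix_neg, diagMatrix_neg, mul_inv_rev, inv_inv, mul_assoc]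
  have hmul : n * n' = 1 := by
    have : (n : ℝ) * n' = 1 := by rw [← hn, ← hn', ← Real.exp_add, add_neg_cancel, Real.exp_zero]
    exact_mod_cast this
  have hpos : 0 < n := by exact_mod_cast hn ▸ Real.exp_pos τ
  rw [Int.eq_one_or_neg_one_of_mul_eq_one hmul |>.resolve_right (by lia), Int.cast_one,
    Real.exp_eq_one_iff] at hn
  exact hn

theorem IsCuspSystem.injOn_param (hg : IsCuspSystem Γ g) (σ : Fin K → ℝ) :
    InjOn (param Γ g 0) (paramDomain σ) := by
  rintro ⟨s, t, κ⟩ ⟨hs, -⟩ ⟨s', t', κ'⟩ ⟨hs', -⟩ h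
  dsimp only at hs hs'
  simp only [param_zero, toCoset_eq_iff, sectionPoint] at h
  obtain ⟨γ, hγ, h⟩ := h
  obtain rfl : κ = κ' := by
    have he : Matrix.SpecialLinearGroup.toGL γ • endpoint (g κ) = endpoint (g κ') := by
      rw [← endpoint_mul_upperMatrix_mul_diagMatrix (g κ) s t,
        ← endpoint_mul_upperMatrix_mul_diagMatrix (g κ') s' t', ← h]
      simp only [endpoint, map_mul, mul_smul]
    exact (hg.existsUnique _ (hg.isCusp κ)).unique ⟨1, Γ.one_mem, by simp⟩ ⟨γ, hγ, he⟩
  have hγ_eq : γ = g κ * (upperMatrix s' * diagMatrix (t' - t) * upperMatrix (-s)) * (g κ)⁻¹ := by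
    rw [eq_mul_inv_of_mul_eq h, sub_eq_add_neg, diagMatrix_add, diagMatrix_neg, upperMatrix_neg]
    group
  rw [hγ_eq] at hγ
  have ht := hg.eq_zero_of_conj_mem hγ
  rw [ht, diagMatrix_zero, mul_one, ← upperMatrix_add, hg.conj_upperMatrix_mem_iff] at hγ
  have hfract : Int.fract s' = Int.fract s :=
    Int.fract_eq_fract.2 (by simpa only [sub_eq_add_neg] using hγ)
  rw [Int.fract_eq_self.2 hs, Int.fract_eq_self.2 hs'] at hfract
  rw [hfract, sub_eq_zero.1 ht]

end Param

/-! ### The measure on the section -/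

section SectionMeasure

variable {K : ℕ} (σ : Fin K → ℝ)

theorem measurableSet_paramDomain : MeasurableSet (paramDomain σ) :=
  (measurable_fst measurableSet_Ico).inter
    (measurableSet_le ((measurable_of_countable σ).comp measurable_snd.snd) measurable_snd.fst)

instance : SigmaFinite (sheetLebesgue K) := by
  unfold sheetLebesgue
  infer_instance

instance : SigmaFinite (sectionMeasure σ) := by
  unfold sectionMeasure
  infer_instance

theorem sectionMeasure_eq_restrict : sectionMeasure σ =
    ((volume : Measure ℝ).prod (expMeasure.prod Measure.count)).restrict (paramDomain σ) := by
  rw [sectionMeasure, ← restrict_withDensity (measurableSet_paramDomain σ), sheetLebesgue,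
    expMeasure, prod_withDensity_left (by fun_prop), prod_withDensity_right (by fun_prop)]

theorem sectionMeasure_absolutelyContinuous : sectionMeasure σ ≪ sheetLebesgue K :=
  (withDensity_absolutelyContinuous _ _).trans Measure.restrict_le_self.absolutelyContinuous

theorem ae_mem_paramDomain : ∀ᵐ w ∂(sectionMeasure σ), w ∈ paramDomain σ :=
  sectionMeasure_eq_restrict σ ▸ ae_restrict_mem (measurableSet_paramDomain σ)

theorem prod_sectionMeasure_apply {A : Set (ℝ × ℝ × ℝ × Fin K)}
    (hA : ∀ q ∈ A, q.2 ∈ paramDomain σ) :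
    (volume : Measure ℝ).prod (sectionMeasure σ) A =
      (volume : Measure ℝ).prod ((volume : Measure ℝ).prod (expMeasure.prod Measure.count)) A := by
  rw [sectionMeasure_eq_restrict, ← Measure.restrict_univ (μ := (volume : Measure ℝ)),
    Measure.prod_restrict, Measure.restrict_univ, Measure.restrict_eq_self]
  exact fun q hq => ⟨mem_univ _, hA q hq⟩

theorem prod_prod_prod_count_apply {X Y Z ι : Type*} [MeasurableSpace X] [MeasurableSpace Y]
    [MeasurableSpace Z] [Fintype ι] [MeasurableSpace ι] [MeasurableSingletonClass ι]
    (μ : Measure X) (ν : Measure Y) (ρ : Measure Z) [SFinite μ] [SFinite ν] [SFinite ρ]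
    {A : Set (X × Y × Z × ι)} (hA : MeasurableSet A) :
    μ.prod (ν.prod (ρ.prod Measure.count)) A =
      ∑ i, μ.prod (ν.prod ρ) {q | (q.1, q.2.1, q.2.2, i) ∈ A} := by
  have hassoc := ((MeasurePreserving.id μ).prod
    (measurePreserving_prodAssoc ν ρ (Measure.count (α := ι)))).comp
      (measurePreserving_prodAssoc μ (ν.prod ρ) (Measure.count (α := ι)))
  rw [← hassoc.measure_preimage hA.nullMeasurableSet,
    Measure.prod_apply_symm (hassoc.measurable hA), lintegral_count, tsum_fintype]
  rfl

end SectionMeasure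

/-! ### The flow box -/

theorem measure_image_toCoset {Γ : Subgroup SL2R} [Countable Γ] {m : Measure SL2R}
    [m.IsMulLeftInvariant] {F : Set SL2R} (hF : IsFundamentalDomain Γ F m) {B : Set SL2R}
    (hB : MeasurableSet B) (hinj : InjOn (toCoset Γ) B) (hE : MeasurableSet (toCoset Γ '' B)) :
    liouville Γ m F (toCoset Γ '' B) = m B := by
  have hsat : toCoset Γ ⁻¹' (toCoset Γ '' B) = ⋃ γ : Γ, γ • B := by
    ext h
    simp only [mem_preimage, mem_image, toCoset_eq_iff, mem_iUnion, mem_smul_set, Subtype.exists,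
      exists_prop, Subgroup.mk_smul, smul_eq_mul]
    tauto
  have hdisj : Pairwise (Function.onFun Disjoint fun γ : Γ => (γ • B) ∩ F) := by
    refine fun γ γ' hne => disjoint_left.2 ?_
    rintro _ ⟨⟨b, hb, rfl⟩, -⟩ ⟨⟨b', hb', h⟩, -⟩
    have hbb' : b = b' := by
      refine hinj hb hb' ?_
      rw [← toCoset_mul_left Γ γ.2 b, ← toCoset_mul_left Γ γ'.2 b']
      exact congrArg (toCoset Γ) h.symm
    subst hbb'
    exact hne (Subtype.ext (mul_right_cancel h)).symm
  rw [liouville_apply hE, hsat, iUnion_inter,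
    measure_iUnion₀ (fun _ _ hne => (hdisj hne).aedisjoint)
      fun γ => (hB.const_smul γ).nullMeasurableSet.inter hF.nullMeasurableSet, hF.measure_eq_tsum]

section FlowBox

variable (Γ : Subgroup SL2R) {K : ℕ} (g : Fin K → SL2R) (σ : Fin K → ℝ)

/-- Lift of `flowBox` to `SL(2, ℝ)`. -/
def flowBoxLift (ε : ℝ) (q : ℝ × ℝ × ℝ × Fin K) : SL2R :=
  sectionPoint g q.2 * lowerMatrix (-(ε * q.1))

/-- The point from which the orbit `r ↦ h⁺_{ε r}` reaches the point with parameter `w` of the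
section at time `r`, as a function of `(r, w)`. -/
def flowBox (ε : ℝ) (q : ℝ × ℝ × ℝ × Fin K) : CosetSpace Γ :=
  unstableFlow Γ (-(ε * q.1)) (param Γ g 0 q.2)

/-- The set of `(r, w)` such that the section is not hit strictly before time `r` when starting at
the point with parameter `w` in the direction opposite to `ε`. -/
def boxDomain (ε : ℝ) : Set (ℝ × ℝ × ℝ × Fin K) :=
  {q | q.2 ∈ paramDomain σ ∧ 0 < q.1 ∧ ENNReal.ofReal q.1 ≤ firstHit Γ g σ (-ε) (param Γ g 0 q.2)}

theorem flowBox_eq_comp (ε : ℝ) : flowBox Γ g ε = toCoset Γ ∘ flowBoxLift g ε := by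
  funext q
  simp only [flowBox, param_zero, unstableFlow_toCoset, flowBoxLift, Function.comp_apply]

theorem continuous_flowBoxLift (ε : ℝ) : Continuous (flowBoxLift g ε) := by
  unfold flowBoxLift
  have := continuous_sectionPoint g
  fun_prop

theorem continuous_flowBox (ε : ℝ) : Continuous (flowBox Γ g ε) :=
  flowBox_eq_comp Γ g ε ▸ (continuous_toCoset Γ).comp (continuous_flowBoxLift g ε)

theorem unstableFlow_flowBox (ε : ℝ) (q : ℝ × ℝ × ℝ × Fin K) :
    unstableFlow Γ (ε * q.1) (flowBox Γ g ε q) = param Γ g 0 q.2 := by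
  rw [flowBox, ← unstableFlow_add, neg_add_cancel, unstableFlow_zero]

theorem flowBoxLift_eq_cell (ε : ℝ) (q : ℝ × ℝ × ℝ × Fin K) :
    flowBoxLift g ε q = g q.2.2.2 * cell (ε * q.1, q.2.1, q.2.2.1) := by
  simp only [flowBoxLift, sectionPoint, cell, mul_assoc]

theorem image_flowBoxLift {ε : ℝ} (hε : ε * ε = 1) (A : Set (ℝ × ℝ × ℝ × Fin K)) :
    flowBoxLift g ε '' A =
      ⋃ κ, (g κ * ·) '' (cell '' {q | (ε * q.1, q.2.1, q.2.2, κ) ∈ A}) := by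
  have hε' (r : ℝ) : ε * (ε * r) = r := by rw [← mul_assoc, hε, one_mul]
  ext h
  simp only [mem_image, mem_iUnion, exists_exists_and_eq_and, mem_ofPred_eq, flowBoxLift_eq_cell]
  constructor
  · rintro ⟨⟨r, s, t, κ⟩, hq, rfl⟩
    exact ⟨κ, (ε * r, s, t), by simpa only [hε'] using hq, rfl⟩
  · rintro ⟨κ, ⟨r, s, t⟩, hq, rfl⟩
    exact ⟨_, hq, by simp only [hε']⟩

theorem isOpenMap_flowBox {ε : ℝ} (hε : ε * ε = 1) : IsOpenMap (flowBox Γ g ε) := by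
  rw [flowBox_eq_comp]
  refine (isOpenQuotientMap_toCoset Γ).isOpenMap.comp fun U hU => ?_
  rw [image_flowBoxLift g hε]
  refine isOpen_iUnion fun κ => isOpenMap_mul_left (g κ) _ (isOpenMap_cell _ (hU.preimage ?_))
  fun_prop

variable {Γ g σ}

theorem param_mem_multiSection {w : ℝ × ℝ × Fin K} (hw : w ∈ paramDomain σ) :
    param Γ g 0 w ∈ multiSection Γ g σ 0 := by
  refine mem_iUnion.2 ⟨w.2.2, mem_iUnion₂.2 ⟨w.2.1 + 0, ?_, _, ⟨w.1, rfl⟩, rfl⟩⟩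
  simpa using hw.2

theorem IsCuspSystem.exists_param_eq (hg : IsCuspSystem Γ g) {y : CosetSpace Γ}
    (hy : y ∈ multiSection Γ g σ 0) : ∃ w ∈ paramDomain σ, param Γ g 0 w = y := by
  obtain ⟨κ, hy⟩ := mem_iUnion.1 hy
  obtain ⟨t, ht, -, ⟨s, rfl⟩, rfl⟩ := mem_iUnion₂.1 hy
  refine ⟨(Int.fract s, t, κ), ⟨⟨Int.fract_nonneg s, Int.fract_lt_one s⟩, by simpa using ht⟩, ?_⟩
  simp only [param, add_zero]
  congr 1
  rw [stableFlow_toCoset, stableFlow_toCoset, toCoset_eq_iff]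
  refine ⟨_, (hg.conj_upperMatrix_mem_iff κ ⌊s⌋).2 ⟨_, rfl⟩, ?_⟩
  rw [mul_assoc, inv_mul_cancel_left, mul_assoc, ← upperMatrix_add, Int.floor_add_fract]

theorem sub_mem_hitSet_flowBox_iff {ε : ℝ} {q : ℝ × ℝ × ℝ × Fin K} {r : ℝ} :
    q.1 - r ∈ hitSet Γ g σ (-ε) (param Γ g 0 q.2) ↔
      r < q.1 ∧ unstableFlow Γ (ε * r) (flowBox Γ g ε q) ∈ multiSection Γ g σ 0 := by
  rw [flowBox, ← unstableFlow_add, hitSet, mem_ofPred_eq, sub_pos]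
  ring_nf

theorem isLeast_hitSet_flowBox {ε : ℝ} {q : ℝ × ℝ × ℝ × Fin K} (hq : q ∈ boxDomain Γ g σ ε) :
    IsLeast (hitSet Γ g σ ε (flowBox Γ g ε q)) q.1 := by
  obtain ⟨hw, h0, hle⟩ := hq
  refine ⟨⟨h0, unstableFlow_flowBox Γ g ε q ▸ param_mem_multiSection hw⟩, ?_⟩
  rintro r ⟨hr, hhit⟩
  by_contra! hlt
  have := hle.trans (iInf₂_le _ (sub_mem_hitSet_flowBox_iff.2 ⟨hlt, hhit⟩))
  rw [ENNReal.ofReal_le_ofReal_iff (sub_pos.2 hlt).le] at this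
  linarith

theorem mem_boxDomain_of_isLeast {ε : ℝ} {q : ℝ × ℝ × ℝ × Fin K} (hw : q.2 ∈ paramDomain σ)
    (h : IsLeast (hitSet Γ g σ ε (flowBox Γ g ε q)) q.1) : q ∈ boxDomain Γ g σ ε := by
  refine ⟨hw, h.1.1, le_iInf₂ fun r hr => ENNReal.ofReal_le_ofReal ?_⟩
  by_contra! hlt
  have hsub := sub_mem_hitSet_flowBox_iff (r := q.1 - r) |>.1 (by rwa [sub_sub_cancel])
  linarith [h.2 ⟨sub_pos.2 hlt, hsub.2⟩, hr.1]

theorem flowBox_eq_iff {ε r : ℝ} {w : ℝ × ℝ × Fin K} {x : CosetSpace Γ} :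
    flowBox Γ g ε (r, w) = x ↔ param Γ g 0 w = unstableFlow Γ (ε * r) x := by
  constructor
  · rintro rfl
    exact (unstableFlow_flowBox Γ g ε (r, w)).symm
  · intro h
    rw [flowBox, h, ← unstableFlow_add, add_neg_cancel, unstableFlow_zero]

theorem IsCuspSystem.injOn_flowBox (hg : IsCuspSystem Γ g) (ε : ℝ) :
    InjOn (flowBox Γ g ε) (boxDomain Γ g σ ε) := by
  intro q hq q' hq' h
  have hr : q.1 = q'.1 := (h ▸ isLeast_hitSet_flowBox hq).unique (isLeast_hitSet_flowBox hq')
  refine Prod.ext hr (hg.injOn_param σ hq.1 hq'.1 ?_)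
  rw [← unstableFlow_flowBox Γ g ε q, ← unstableFlow_flowBox Γ g ε q', h, hr]

theorem IsCuspSystem.injOn_flowBoxLift (hg : IsCuspSystem Γ g) (ε : ℝ) :
    InjOn (flowBoxLift g ε) (boxDomain Γ g σ ε) :=
  InjOn.of_comp (flowBox_eq_comp Γ g ε ▸ hg.injOn_flowBox ε)

section Discrete

variable [DiscreteTopology Γ] (hg : IsCuspSystem Γ g) {ε : ℝ}
include hg

theorem IsCuspSystem.measurable_firstHit_param (hε : ε * ε = 1) :
    Measurable fun w => firstHit Γ g σ ε (param Γ g 0 w) :=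
  (hg.lowerSemicontinuous_firstHit_param hε).measurable

theorem IsCuspSystem.measurableSet_boxDomain (hε : ε * ε = 1) :
    MeasurableSet (boxDomain Γ g σ ε) :=
  (measurable_snd (measurableSet_paramDomain σ)).inter
    ((measurableSet_lt measurable_const measurable_fst).inter
      (measurableSet_le measurable_fst.ennreal_ofReal
        ((hg.measurable_firstHit_param (by rwa [neg_mul_neg])).comp measurable_snd)))

theorem IsCuspSystem.measurableSet_image_flowBox {A : Set (ℝ × ℝ × ℝ × Fin K)}
    (hA : MeasurableSet A) (hAb : A ⊆ boxDomain Γ g σ ε) : MeasurableSet (flowBox Γ g ε '' A) :=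
  hA.image_of_continuousOn_injOn (continuous_flowBox Γ g ε).continuousOn
    ((hg.injOn_flowBox ε).mono hAb)

end Discrete

end FlowBox

/-! ### The Liouville measure in the flow box -/

theorem measurePreserving_mul_left_of_mul_self_eq_one {ε : ℝ} (hε : ε * ε = 1) :
    MeasurePreserving (ε * ·) (volume : Measure ℝ) volume := by
  rcases mul_self_eq_one_iff.1 hε with rfl | rfl
  · simp only [one_mul]
    exact .id volume
  · simpa only [neg_one_mul] using Measure.measurePreserving_neg (volume : Measure ℝ)

theorem volume_setOf_ofReal_le (η : ENNReal) :
    volume {r : ℝ | 0 < r ∧ ENNReal.ofReal r ≤ η} = η := by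
  by_cases h : η = ⊤
  · simp only [h, le_top, and_true]
    exact Real.volume_Ioi
  · simp only [ENNReal.ofReal_le_iff_le_toReal h]
    exact (Real.volume_Ioc (a := 0)).trans (by rw [sub_zero, ENNReal.ofReal_toReal h])

theorem isProbabilityMeasure_liouville {Γ : Subgroup SL2R} {m : Measure SL2R} {F : Set SL2R}
    (hmF : m F = 1) : IsProbabilityMeasure (liouville Γ m F) :=
  have : IsProbabilityMeasure (m.restrict F) := ⟨by rw [Measure.restrict_apply_univ, hmF]⟩
  Measure.isProbabilityMeasure_map (continuous_toCoset Γ).measurable.aemeasurable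

theorem IsCuspSystem.prod_sectionMeasure_boxDomain {Γ : Subgroup SL2R}
    [DiscreteTopology Γ] {K : ℕ} {g : Fin K → SL2R} (hg : IsCuspSystem Γ g) (σ : Fin K → ℝ) {ε : ℝ}
    (hε : ε * ε = 1) :
    (volume : Measure ℝ).prod (sectionMeasure σ) (boxDomain Γ g σ ε) =
      ∫⁻ w, firstHit Γ g σ (-ε) (param Γ g 0 w) ∂(sectionMeasure σ) := by
  rw [Measure.prod_apply_symm (hg.measurableSet_boxDomain hε)]
  refine lintegral_congr_ae ?_
  filter_upwards [ae_mem_paramDomain σ] with w hw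
  rw [← volume_setOf_ofReal_le (firstHit Γ g σ (-ε) (param Γ g 0 w))]
  simp only [boxDomain, preimage_ofPred_eq, hw, true_and]

section FlowBoxMeasure

variable {Γ : Subgroup SL2R} {K : ℕ} {g : Fin K → SL2R} {σ : Fin K → ℝ} {m : Measure SL2R}
  [m.IsHaarMeasure] {F : Set SL2R} {ε : ℝ}

theorem measure_image_flowBoxLift {k : NNReal} (hk : m.comap cell =
      k • (volume : Measure ℝ).prod ((volume : Measure ℝ).prod expMeasure)) (hε : ε * ε = 1)
    {A : Set (ℝ × ℝ × ℝ × Fin K)} (hA : MeasurableSet A) (hinj : InjOn (flowBoxLift g ε) A) :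
    m (flowBoxLift g ε '' A) =
      k * (volume : Measure ℝ).prod ((volume : Measure ℝ).prod (expMeasure.prod .count)) A := by
  have hflip : MeasurePreserving (fun q : ℝ × ℝ × ℝ × Fin K => (ε * q.1, q.2))
      (volume.prod (volume.prod (expMeasure.prod .count)))
      (volume.prod (volume.prod (expMeasure.prod .count))) :=
    (measurePreserving_mul_left_of_mul_self_eq_one hε).prod (.id _)
  have hA' := hflip.measurable hA
  have hslice (κ : Fin K) : MeasurableSet {q : ℝ × ℝ × ℝ | (ε * q.1, q.2.1, q.2.2, κ) ∈ A} :=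
    (by fun_prop : Measurable fun q : ℝ × ℝ × ℝ => (ε * q.1, q.2.1, q.2.2, κ)) hA
  rw [image_flowBoxLift g hε, measure_iUnion, tsum_fintype,
    ← hflip.measure_preimage hA.nullMeasurableSet, prod_prod_prod_count_apply _ _ _ hA',
    Finset.mul_sum]
  · refine Finset.sum_congr rfl fun κ _ => ?_
    rw [image_mul_left, measure_preimage_mul,
      ← isOpenEmbedding_cell.measurableEmbedding.comap_apply, hk]
    rfl
  · refine fun κ κ' hne => disjoint_left.2 ?_
    rintro _ ⟨_, ⟨q, hq, rfl⟩, rfl⟩ ⟨_, ⟨q', hq', rfl⟩, h⟩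
    have hε' (r : ℝ) : ε * (ε * r) = r := by rw [← mul_assoc, hε, one_mul]
    have heq := hinj hq' hq (by simpa only [flowBoxLift_eq_cell, hε'] using h)
    exact hne (congrArg (fun q : ℝ × ℝ × ℝ × Fin K => q.2.2.2) heq).symm
  · exact fun κ => (Homeomorph.mulLeft (g κ)).measurableEmbedding.measurableSet_image.2
      (isOpenEmbedding_cell.measurableEmbedding.measurableSet_image.2 (hslice κ))

variable [DiscreteTopology Γ] (hF : IsFundamentalDomain Γ F m)
include hF

theorem IsCuspSystem.exists_liouville_image_flowBox (hg : IsCuspSystem Γ g) :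
    ∃ k : NNReal, ∀ ε : ℝ, ε * ε = 1 → ∀ A : Set (ℝ × ℝ × ℝ × Fin K), MeasurableSet A →
      A ⊆ boxDomain Γ g σ ε →
      liouville Γ m F (flowBox Γ g ε '' A) =
        k * (volume : Measure ℝ).prod (sectionMeasure σ) A := by
  have := countable_of_discreteTopology Γ
  obtain ⟨k, hk⟩ := exists_comap_cell_eq m
  refine ⟨k, fun ε hε A hA hAb => ?_⟩
  have hinj := (hg.injOn_flowBox ε).mono hAb
  have hE := hg.measurableSet_image_flowBox hA hAb
  have hlift := (hg.injOn_flowBoxLift ε).mono hAb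
  rw [flowBox_eq_comp] at hinj hE ⊢
  rw [image_comp] at hE ⊢
  rw [measure_image_toCoset hF (hA.image_of_continuousOn_injOn
      (continuous_flowBoxLift g ε).continuousOn hlift) hinj.image_of_comp hE,
    measure_image_flowBoxLift hk hε hA hlift, prod_sectionMeasure_apply σ fun q hq => (hAb hq).1]

theorem IsCuspSystem.liouville_compl_image_boxDomain (hg : IsCuspSystem Γ g)
    (hneg : (-1 : SL2R) ∈ Γ) (hK : 0 < K) (hmF : m F ≠ ⊤) (hε : ε * ε = 1) :
    liouville Γ m F (flowBox Γ g ε '' boxDomain Γ g σ ε)ᶜ = 0 := by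
  have hE := hg.measurableSet_image_flowBox (hg.measurableSet_boxDomain hε (σ := σ)) subset_rfl
  rw [liouville, Measure.map_apply (continuous_toCoset Γ).measurable hE.compl]
  refine measure_mono_null ?_ (ae_iff.1 (ae_nonempty_hitSet hneg hF hmF hK g σ hε))
  intro h hh hne
  obtain ⟨r, hr⟩ := hg.exists_isLeast_hitSet hε hne
  obtain ⟨w, hw, hwx⟩ := hg.exists_param_eq hr.1.2
  have hq : flowBox Γ g ε (r, w) = toCoset Γ h := flowBox_eq_iff.2 hwx
  exact hh ⟨(r, w), mem_boxDomain_of_isLeast hw (hq.symm ▸ hr), hq⟩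

theorem IsCuspSystem.liouville_image_boxDomain (hg : IsCuspSystem Γ g)
    (hneg : (-1 : SL2R) ∈ Γ) (hK : 0 < K) (hmF : m F = 1) (hε : ε * ε = 1) :
    liouville Γ m F (flowBox Γ g ε '' boxDomain Γ g σ ε) = 1 := by
  have := isProbabilityMeasure_liouville (Γ := Γ) hmF
  rw [← prob_compl_eq_zero_iff
    (hg.measurableSet_image_flowBox (hg.measurableSet_boxDomain hε) subset_rfl)]
  exact hg.liouville_compl_image_boxDomain hF hneg hK (hmF ▸ ENNReal.one_ne_top) hε

-- The constant is computed by flowing backwards: the flow box for `ε = -1` has return times `η₁`.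
theorem IsCuspSystem.liouville_image_flowBox (hg : IsCuspSystem Γ g) (hneg : (-1 : SL2R) ∈ Γ)
    (hK : 0 < K) (hmF : m F = 1) (hε : ε * ε = 1) {A : Set (ℝ × ℝ × ℝ × Fin K)}
    (hA : MeasurableSet A) (hAb : A ⊆ boxDomain Γ g σ ε) :
    liouville Γ m F (flowBox Γ g ε '' A) =
      (meanReturnTime Γ g σ)⁻¹ * (volume : Measure ℝ).prod (sectionMeasure σ) A := by
  have hε' : (-1 : ℝ) * -1 = 1 := by norm_num
  obtain ⟨k, hk⟩ := hg.exists_liouville_image_flowBox (σ := σ) hF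
  have hmean : k * meanReturnTime Γ g σ = 1 := by
    simp only [meanReturnTime, returnTime, hittingTime_eq_firstHit]
    rw [← neg_neg (1 : ℝ), ← hg.prod_sectionMeasure_boxDomain σ hε',
      ← hk (-1) hε' _ (hg.measurableSet_boxDomain hε') subset_rfl]
    exact hg.liouville_image_boxDomain hF hneg hK hmF hε'
  rw [hk ε hε A hA hAb, ENNReal.eq_inv_of_mul_eq_one_left hmean]

end FlowBoxMeasure

/-! ### Renormalisation by the geodesic flow -/

section Renormalisation

variable (Γ : Subgroup SL2R) {K : ℕ} (g : Fin K → SL2R) (σ : Fin K → ℝ) (R : ℝ)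

theorem geodesicFlow_injective (t : ℝ) : Function.Injective (geodesicFlow Γ t) :=
  Function.LeftInverse.injective (geodesicFlow_neg_geodesicFlow Γ t)

theorem param_eq_geodesicFlow (w : ℝ × ℝ × Fin K) :
    param Γ g R w = geodesicFlow Γ R (param Γ g 0 w) := by
  simp only [param, add_zero, geodesicFlow_add]

theorem geodesicFlow_mem_multiSection_iff (y : CosetSpace Γ) :
    geodesicFlow Γ R y ∈ multiSection Γ g σ R ↔ y ∈ multiSection Γ g σ 0 := by
  simp only [multiSection, cuspSection, mem_iUnion, mem_image, mem_Ici, exists_prop, add_zero]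
  refine exists_congr fun κ => ⟨?_, ?_⟩
  · rintro ⟨t, ht, x, hx, h⟩
    refine ⟨t - R, by linarith, x, hx, geodesicFlow_injective Γ R ?_⟩
    rw [← geodesicFlow_add, sub_add_cancel, h]
  · rintro ⟨t, ht, x, hx, rfl⟩
    exact ⟨t + R, by linarith, x, hx, geodesicFlow_add Γ t R x⟩

theorem exp_neg_mul_hittingTime (y : CosetSpace Γ) :
    ENNReal.ofReal (Real.exp (-R)) * hittingTime Γ g σ R (geodesicFlow Γ R y) =
      hittingTime Γ g σ 0 y := by
  have h0 : ENNReal.ofReal (Real.exp (-R)) ≠ 0 := by simpa using Real.exp_pos (-R)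
  simp only [hittingTime, ENNReal.mul_iInf_of_ne h0 ENNReal.ofReal_ne_top,
    ← ENNReal.ofReal_mul (Real.exp_pos (-R)).le, unstableFlow_geodesicFlow,
    geodesicFlow_mem_multiSection_iff]
  refine le_antisymm (le_iInf₂ fun r hr => ?_) (le_iInf₂ fun r hr => ?_)
  · have hcancel : Real.exp (-R) * (Real.exp R * r) = r := by
      rw [← mul_assoc, ← Real.exp_add, neg_add_cancel, Real.exp_zero, one_mul]
    exact (iInf₂_le (Real.exp R * r) ⟨mul_pos (Real.exp_pos _) hr.1, hcancel.symm ▸ hr.2⟩).trans_eq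
      (by rw [hcancel])
  · exact iInf₂_le (Real.exp (-R) * r) ⟨mul_pos (Real.exp_pos _) hr.1, hr.2⟩

theorem isFirstImpact_geodesicFlow_iff (y : CosetSpace Γ) (w : ℝ × ℝ × Fin K) :
    IsFirstImpact Γ g σ R (geodesicFlow Γ R y) w ↔ IsFirstImpact Γ g σ 0 y w := by
  have hscale := exp_neg_mul_hittingTime Γ g σ R y
  have hfinite : hittingTime Γ g σ R (geodesicFlow Γ R y) ≠ ⊤ ↔ hittingTime Γ g σ 0 y ≠ ⊤ := by
    simp [← hscale, ENNReal.mul_eq_top, Real.exp_pos (-R)]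
  have htoReal : Real.exp (-R) * (hittingTime Γ g σ R (geodesicFlow Γ R y)).toReal =
      (hittingTime Γ g σ 0 y).toReal := by
    rw [← hscale, ENNReal.toReal_mul, ENNReal.toReal_ofReal (Real.exp_pos _).le]
  unfold IsFirstImpact
  rw [hfinite, param_eq_geodesicFlow, unstableFlow_geodesicFlow, htoReal,
    (geodesicFlow_injective Γ R).eq_iff]

/-- The set of initial points for which the first hit of `H(σ, 0)` takes place after time `X` and
with impact parameter in `D`. -/
def impactSet (X : ℝ) (D : Set (ℝ × ℝ × Fin K)) : Set (CosetSpace Γ) :=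
  {x | ENNReal.ofReal X < hittingTime Γ g σ 0 x ∧ ∃ w ∈ D, IsFirstImpact Γ g σ 0 x w}

theorem setOf_firstImpact_eq_image (X : ℝ) (D : Set (ℝ × ℝ × Fin K)) :
    {x : CosetSpace Γ |
      ENNReal.ofReal X < ENNReal.ofReal (Real.exp (-R)) * hittingTime Γ g σ R x ∧
      ∃ w ∈ D, IsFirstImpact Γ g σ R x w} = geodesicFlow Γ R '' impactSet Γ g σ X D := by
  rw [image_eq_preimage_of_inverse (geodesicFlow_neg_geodesicFlow Γ R)
    (geodesicFlow_geodesicFlow_neg Γ R)]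
  ext x
  obtain ⟨y, rfl⟩ : ∃ y, geodesicFlow Γ R y = x := ⟨_, geodesicFlow_geodesicFlow_neg Γ R x⟩
  simp only [impactSet, mem_ofPred_eq, mem_preimage, geodesicFlow_neg_geodesicFlow,
    exp_neg_mul_hittingTime, isFirstImpact_geodesicFlow_iff]

end Renormalisation

/-! ### The impact set in the flow box -/

theorem frontier_image_inter_subset {X Y : Type*} [TopologicalSpace X] [TopologicalSpace Y]
    {f : X → Y} (hf : IsOpenMap f) {B : Set X} (hinj : InjOn f B) (S : Set X) :
    frontier (f '' (B ∩ S)) ⊆ f '' ((B \ interior B) ∪ (B ∩ frontier S)) ∪ (f '' B)ᶜ := by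
  intro y hy
  by_contra hcon
  simp only [mem_union, mem_compl_iff, not_or, not_not] at hcon
  obtain ⟨hnot, q, hq, rfl⟩ := hcon
  have hqB : q ∈ interior B := by_contra fun h => hnot ⟨q, .inl ⟨hq, h⟩, rfl⟩
  have hqS : q ∉ frontier S := fun h => hnot ⟨q, .inr ⟨hq, h⟩, rfl⟩
  by_cases hin : q ∈ interior S
  · refine hy.2 (interior_maximal (image_mono ?_) (hf _ (isOpen_interior.inter isOpen_interior))
      (mem_image_of_mem f ⟨hqB, hin⟩))
    exact inter_subset_inter interior_subset interior_subset
  · have hout : q ∈ (closure S)ᶜ := fun h => hqS ⟨h, hin⟩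
    obtain ⟨_, ⟨q₁, hq₁, rfl⟩, q₂, hq₂, h⟩ := mem_closure_iff.1 hy.1 _
      (hf _ (isOpen_interior.inter isClosed_closure.isOpen_compl)) (mem_image_of_mem f ⟨hqB, hout⟩)
    obtain rfl := hinj hq₂.1 (interior_subset hq₁.1) h
    exact hq₁.2 (subset_closure hq₂.2)

theorem measure_prod_graph_eq_zero {X Y : Type*} [MeasurableSpace X] [MeasurableSpace Y]
    [MeasurableEq X] (μ : Measure X) [SFinite μ] [NullSingletonClass μ] (ν : Measure Y) [SFinite ν]
    {c : Y → X} (hc : Measurable c) : μ.prod ν {q | q.1 = c q.2} = 0 := by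
  have hgraph : MeasurableSet {q : X × Y | q.1 = c q.2} :=
    measurableSet_eq_fun measurable_fst (hc.comp measurable_snd)
  rw [Measure.prod_apply_symm hgraph]
  simp

section ImpactBox

variable {Γ : Subgroup SL2R} {K : ℕ} {g : Fin K → SL2R} {σ : Fin K → ℝ}

variable (Γ g σ) in
/-- The set of `(r, w)` in the flow box with `r > X` and `w ∈ D`, which is `impactSet` in the
coordinates of the flow box. -/
def impactBox (X : ℝ) (D : Set (ℝ × ℝ × Fin K)) : Set (ℝ × ℝ × ℝ × Fin K) :=
  boxDomain Γ g σ 1 ∩ Ioi X ×ˢ D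

theorem sectionMeasure_paramDomain_sdiff_interior (σ : Fin K → ℝ) :
    sectionMeasure σ (paramDomain σ \ interior (paramDomain σ)) = 0 := by
  have hσ : Continuous σ := continuous_of_discreteTopology
  have hopen : IsOpen {w : ℝ × ℝ × Fin K | w.1 ∈ Ioo (0 : ℝ) 1 ∧ σ w.2.2 < w.2.1} :=
    (isOpen_Ioo.preimage continuous_fst).inter
      (isOpen_lt (hσ.comp continuous_snd.snd) continuous_snd.fst)
  have hleft : sheetLebesgue K (Prod.fst ⁻¹' {0}) = 0 :=
    Measure.quasiMeasurePreserving_fst.preimage_null (measure_singleton _)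
  have hbottom (κ : Fin K) : sheetLebesgue K (Prod.snd ⁻¹' (Prod.fst ⁻¹' {σ κ})) = 0 :=
    Measure.quasiMeasurePreserving_snd.preimage_null
      (Measure.quasiMeasurePreserving_fst.preimage_null (measure_singleton _))
  refine sectionMeasure_absolutelyContinuous σ
    (measure_mono_null ?_ (measure_union_null hleft (measure_iUnion_null hbottom)))
  rintro w ⟨⟨hs, ht⟩, hn⟩
  by_contra hcon
  simp only [mem_union, mem_preimage, mem_singleton_iff, mem_iUnion, not_or, not_exists] at hcon
  have hsub : {w : ℝ × ℝ × Fin K | w.1 ∈ Ioo (0 : ℝ) 1 ∧ σ w.2.2 < w.2.1} ⊆ paramDomain σ :=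
    fun w hw => ⟨Ioo_subset_Ico_self hw.1, hw.2.le⟩
  exact hn (interior_maximal hsub hopen
    ⟨⟨hs.1.lt_of_ne' hcon.1, hs.2⟩, ht.lt_of_ne' (hcon.2 _)⟩)

theorem impactSet_eq_image {X : ℝ} (hX : 0 ≤ X) (D : Set (ℝ × ℝ × Fin K)) :
    impactSet Γ g σ X D = flowBox Γ g 1 '' impactBox Γ g σ X D := by
  ext x
  constructor
  · rintro ⟨hXx, w, hwD, hfin, hw, hwx⟩
    rw [ENNReal.ofReal_lt_iff_lt_toReal hX hfin] at hXx
    rw [hittingTime_eq_firstHit] at hfin hXx hwx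
    set r := (firstHit Γ g σ 1 x).toReal
    have hq : flowBox Γ g 1 (r, w) = x := flowBox_eq_iff.2 (by rw [one_mul, hwx])
    have hleast : IsLeast (hitSet Γ g σ 1 x) r := by
      refine ⟨⟨hX.trans_lt hXx, ?_⟩, fun r' hr' => ?_⟩
      · rw [one_mul, ← hwx]
        exact param_mem_multiSection hw
      · exact ENNReal.toReal_le_of_le_ofReal hr'.1.le (iInf₂_le r' hr')
    exact ⟨(r, w), ⟨mem_boxDomain_of_isLeast hw (by rwa [hq]), hXx, hwD⟩, hq⟩
  · rintro ⟨q, ⟨hq, hXq, hqD⟩, rfl⟩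
    have hpos : 0 < q.1 := hX.trans_lt hXq
    have htime : hittingTime Γ g σ 0 (flowBox Γ g 1 q) = ENNReal.ofReal q.1 :=
      (hittingTime_eq_firstHit Γ g σ _).trans (firstHit_eq_of_isLeast (isLeast_hitSet_flowBox hq))
    refine ⟨htime ▸ (ENNReal.ofReal_lt_ofReal_iff hpos).2 hXq, q.2, hqD,
      htime ▸ ENNReal.ofReal_ne_top, hq.1, ?_⟩
    rw [htime, ENNReal.toReal_ofReal hpos.le, ← unstableFlow_flowBox Γ g 1 q, one_mul]

variable [DiscreteTopology Γ]

theorem IsCuspSystem.isOpen_setOf_lt_firstHit_param (hg : IsCuspSystem Γ g) {ε : ℝ}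
    (hε : ε * ε = 1) :
    IsOpen {q : ℝ × ℝ × ℝ × Fin K | ENNReal.ofReal q.1 < firstHit Γ g σ ε (param Γ g 0 q.2)} := by
  have hclosed := (hg.lowerSemicontinuous_firstHit_param (σ := σ) hε).isClosed_epigraph.preimage
    (continuous_snd.prodMk (ENNReal.continuous_ofReal.comp continuous_fst))
  simpa only [preimage_ofPred_eq, compl_ofPred, not_le, Function.comp_apply]
    using hclosed.isOpen_compl

theorem IsCuspSystem.ae_ofReal_ne_firstHit_param (hg : IsCuspSystem Γ g) {ε : ℝ}
    (hε : ε * ε = 1) : ∀ᵐ q ∂(volume : Measure ℝ).prod (sectionMeasure σ),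
      0 < q.1 → ENNReal.ofReal q.1 ≠ firstHit Γ g σ ε (param Γ g 0 q.2) := by
  filter_upwards [compl_mem_ae_iff.2 (measure_prod_graph_eq_zero volume (sectionMeasure σ)
    (hg.measurable_firstHit_param (σ := σ) hε).ennreal_toReal)] with q hq hpos h
  exact hq (by rw [mem_ofPred_eq, ← h, ENNReal.toReal_ofReal hpos.le])

theorem IsCuspSystem.prod_sectionMeasure_boxDomain_sdiff_interior (hg : IsCuspSystem Γ g) {ε : ℝ}
    (hε : ε * ε = 1) : (volume : Measure ℝ).prod (sectionMeasure σ)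
      (boxDomain Γ g σ ε \ interior (boxDomain Γ g σ ε)) = 0 := by
  have hε' : -ε * -ε = 1 := by rwa [neg_mul_neg]
  have hopen : IsOpen (Prod.snd ⁻¹' interior (paramDomain σ) ∩ (Prod.fst ⁻¹' Ioi 0 ∩
      {q : ℝ × ℝ × ℝ × Fin K | ENNReal.ofReal q.1 < firstHit Γ g σ (-ε) (param Γ g 0 q.2)})) :=
    (isOpen_interior.preimage continuous_snd).inter
      ((isOpen_Ioi.preimage continuous_fst).inter (hg.isOpen_setOf_lt_firstHit_param hε'))
  have hsheet : ∀ᵐ q ∂(volume : Measure ℝ).prod (sectionMeasure σ),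
      q.2 ∉ paramDomain σ \ interior (paramDomain σ) :=
    compl_mem_ae_iff.2 (Measure.quasiMeasurePreserving_snd.preimage_null
      (sectionMeasure_paramDomain_sdiff_interior σ))
  refine compl_mem_ae_iff.1 ?_
  filter_upwards [hsheet, hg.ae_ofReal_ne_firstHit_param hε'] with q hw hne ⟨hq, hn⟩
  refine hn (interior_maximal ?_ hopen
    ⟨by_contra fun h => hw ⟨hq.1, h⟩, hq.2.1, hq.2.2.lt_of_ne (hne hq.2.1)⟩)
  exact fun q hq => ⟨interior_subset hq.1, hq.2.1, le_of_lt hq.2.2⟩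

theorem IsCuspSystem.measurableSet_impactBox (hg : IsCuspSystem Γ g) {X : ℝ}
    {D : Set (ℝ × ℝ × Fin K)} (hD : MeasurableSet D) : MeasurableSet (impactBox Γ g σ X D) :=
  (hg.measurableSet_boxDomain (one_mul 1)).inter (measurableSet_Ioi.prod hD)

theorem IsCuspSystem.measurableSet_impactSet (hg : IsCuspSystem Γ g) {X : ℝ} (hX : 0 ≤ X)
    {D : Set (ℝ × ℝ × Fin K)} (hD : MeasurableSet D) : MeasurableSet (impactSet Γ g σ X D) := by
  rw [impactSet_eq_image hX]
  exact hg.measurableSet_image_flowBox (hg.measurableSet_impactBox hD) inter_subset_left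

theorem prod_sectionMeasure_frontier_Ioi_prod (X : ℝ) {D : Set (ℝ × ℝ × Fin K)}
    (hD : sheetLebesgue K (frontier D) = 0) :
    (volume : Measure ℝ).prod (sectionMeasure σ) (frontier (Ioi X ×ˢ D)) = 0 := by
  rw [frontier_prod_eq, frontier_Ioi]
  refine measure_union_null ?_ ?_ <;> rw [Measure.prod_prod]
  · rw [sectionMeasure_absolutelyContinuous σ hD, mul_zero]
  · rw [measure_singleton, zero_mul]

theorem IsCuspSystem.ae_limitDensity_eq_indicator (hg : IsCuspSystem Γ g) :
    ∀ᵐ q ∂(volume : Measure ℝ).prod (sectionMeasure σ), 0 < q.1 →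
      limitDensity Γ g σ q.1 q.2 =
        (boxDomain Γ g σ 1).indicator (fun _ => ((meanReturnTime Γ g σ)⁻¹).toReal) q := by
  have hε : (-1 : ℝ) * -1 = 1 := by norm_num
  have hparam : ∀ᵐ q ∂(volume : Measure ℝ).prod (sectionMeasure σ), q.2 ∈ paramDomain σ :=
    Measure.quasiMeasurePreserving_snd.ae (ae_mem_paramDomain σ)
  filter_upwards [hparam, hg.ae_ofReal_ne_firstHit_param hε] with q hw hne hpos
  have hmem : ENNReal.ofReal q.1 < backwardReturnTime Γ g σ q.2 ↔ q ∈ boxDomain Γ g σ 1 := by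
    rw [backwardReturnTime, backwardHittingTime_eq_firstHit]
    exact ⟨fun h => ⟨hw, hpos, h.le⟩, fun h => h.2.2.lt_of_ne (hne hpos)⟩
  classical
  simp only [limitDensity, indicator_apply, hmem, one_div, ENNReal.toReal_inv]

theorem IsCuspSystem.limitDensity_ae_eq_indicator (hg : IsCuspSystem Γ g) {X : ℝ} (hX : 0 ≤ X)
    {D : Set (ℝ × ℝ × Fin K)} (hD : MeasurableSet D) :
    (fun q : ℝ × ℝ × ℝ × Fin K => limitDensity Γ g σ q.1 q.2)
      =ᵐ[(volume.restrict (Ioi X)).prod ((sectionMeasure σ).restrict D)]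
      (boxDomain Γ g σ 1).indicator fun _ => ((meanReturnTime Γ g σ)⁻¹).toReal := by
  rw [Measure.prod_restrict]
  filter_upwards [ae_restrict_of_ae hg.ae_limitDensity_eq_indicator,
    ae_restrict_mem (measurableSet_Ioi.prod hD)] with q hq hmem
  exact hq (hX.trans_lt hmem.1)

variable {m : Measure SL2R} [m.IsHaarMeasure] {F : Set SL2R}
  (hF : IsFundamentalDomain Γ F m) (hneg : (-1 : SL2R) ∈ Γ) (hK : 0 < K) (hmF : m F = 1)
include hF hneg hK hmF

theorem IsCuspSystem.liouville_frontier_impactSet (hg : IsCuspSystem Γ g) {X : ℝ} (hX : 0 ≤ X)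
    {D : Set (ℝ × ℝ × Fin K)} (hD : sheetLebesgue K (frontier D) = 0) :
    liouville Γ m F (frontier (impactSet Γ g σ X D)) = 0 := by
  have hε : (1 : ℝ) * 1 = 1 := one_mul 1
  have hbox := hg.measurableSet_boxDomain (σ := σ) hε
  rw [impactSet_eq_image hX]
  refine measure_mono_null
    (frontier_image_inter_subset (isOpenMap_flowBox Γ g hε) (hg.injOn_flowBox 1) _)
    (measure_union_null ?_ (hg.liouville_compl_image_boxDomain hF hneg hK
      (hmF ▸ ENNReal.one_ne_top) hε))
  rw [hg.liouville_image_flowBox hF hneg hK hmF hε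
    ((hbox.diff isOpen_interior.measurableSet).union (hbox.inter isClosed_frontier.measurableSet))
    (union_subset sdiff_subset inter_subset_left), measure_union_null, mul_zero]
  · exact hg.prod_sectionMeasure_boxDomain_sdiff_interior hε
  · exact measure_mono_null inter_subset_right (prod_sectionMeasure_frontier_Ioi_prod X hD)

theorem IsCuspSystem.prod_sectionMeasure_boxDomain_ne_top (hg : IsCuspSystem Γ g) :
    (volume : Measure ℝ).prod (sectionMeasure σ) (boxDomain Γ g σ 1) ≠ ⊤ := by
  intro htop
  have h := hg.liouville_image_flowBox hF hneg hK hmF (one_mul 1)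
    (hg.measurableSet_boxDomain (σ := σ) (one_mul 1)) subset_rfl
  rw [hg.liouville_image_boxDomain hF hneg hK hmF (one_mul 1), htop] at h
  have hmean : (meanReturnTime Γ g σ)⁻¹ ≠ 0 := fun h0 => by simp [h0] at h
  rw [ENNReal.mul_top hmean] at h
  exact ENNReal.one_ne_top h
theorem IsCuspSystem.integrable_limitDensity (hg : IsCuspSystem Γ g) {X : ℝ} (hX : 0 ≤ X)
    {D : Set (ℝ × ℝ × Fin K)} (hD : MeasurableSet D) :
    Integrable (fun q : ℝ × ℝ × ℝ × Fin K => limitDensity Γ g σ q.1 q.2)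
      ((volume.restrict (Ioi X)).prod ((sectionMeasure σ).restrict D)) := by
  rw [integrable_congr (hg.limitDensity_ae_eq_indicator hX hD), Measure.prod_restrict]
  exact ((integrable_indicator_iff (hg.measurableSet_boxDomain (one_mul 1))).2 (integrableOn_const
    (hg.prod_sectionMeasure_boxDomain_ne_top hF hneg hK hmF))).restrict

theorem IsCuspSystem.integral_limitDensity (hg : IsCuspSystem Γ g) {X : ℝ} (hX : 0 ≤ X)
    {D : Set (ℝ × ℝ × Fin K)} (hD : MeasurableSet D) :
    ∫ q : ℝ × ℝ × ℝ × Fin K, limitDensity Γ g σ q.1 q.2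
      ∂((volume.restrict (Ioi X)).prod ((sectionMeasure σ).restrict D)) =
      (liouville Γ m F).real (impactSet Γ g σ X D) := by
  have hbox := hg.measurableSet_boxDomain (σ := σ) (one_mul 1)
  rw [integral_congr_ae (hg.limitDensity_ae_eq_indicator hX hD), Measure.prod_restrict,
    integral_indicator_const _ hbox, impactSet_eq_image hX, measureReal_def, measureReal_def,
    Measure.restrict_apply hbox, smul_eq_mul, ← ENNReal.toReal_mul, mul_comm,
    hg.liouville_image_flowBox hF hneg hK hmF (one_mul 1) (hg.measurableSet_impactBox hD)
      inter_subset_left, impactBox]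

theorem IsCuspSystem.liouville_impactSet_zero_univ (hg : IsCuspSystem Γ g) :
    liouville Γ m F (impactSet Γ g σ 0 univ) = 1 := by
  have hbox : impactBox Γ g σ 0 univ = boxDomain Γ g σ 1 :=
    inter_eq_left.2 fun q hq => ⟨hq.2.1, mem_univ _⟩
  rw [impactSet_eq_image le_rfl, hbox, hg.liouville_image_boxDomain hF hneg hK hmF (one_mul 1)]

end ImpactBox

end CuspHitting

end

theorem mainTheorem6
    (Γ : Subgroup CuspHitting.SL2R) (hdisc : DiscreteTopology Γ)
    (hneg : (-1 : CuspHitting.SL2R) ∈ Γ)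
    (m : MeasureTheory.Measure CuspHitting.SL2R) (hm : m.IsHaarMeasure)
    (F : Set CuspHitting.SL2R) (hF : MeasureTheory.IsFundamentalDomain Γ F m) (hmF : m F = 1)
    (K : ℕ) (hK : 0 < K)
    (g : Fin K → CuspHitting.SL2R) (hg : CuspHitting.IsCuspSystem Γ g)
    (lam : MeasureTheory.Measure (CuspHitting.CosetSpace Γ))
    (hlam : MeasureTheory.IsProbabilityMeasure lam)
    (hadm : CuspHitting.IsAdmissible Γ (CuspHitting.liouville Γ m F) lam)
    (σ : Fin K → ℝ) :
    (MeasureTheory.Integrable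
        (fun p : ℝ × (ℝ × ℝ × Fin K) => CuspHitting.limitDensity Γ g σ p.1 p.2)
        ((MeasureTheory.volume.restrict (Set.Ioi (0 : ℝ))).prod (CuspHitting.sectionMeasure σ)) ∧
      ∫ p : ℝ × (ℝ × ℝ × Fin K), CuspHitting.limitDensity Γ g σ p.1 p.2
        ∂((MeasureTheory.volume.restrict (Set.Ioi (0 : ℝ))).prod
          (CuspHitting.sectionMeasure σ)) = 1) ∧
    ∀ X : ℝ, 0 < X → ∀ D : Set (ℝ × ℝ × Fin K), D ⊆ CuspHitting.paramDomain σ →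
      MeasurableSet D → CuspHitting.sheetLebesgue K (frontier D) = 0 →
      Filter.Tendsto
        (fun R : ℝ => lam.real {x : CuspHitting.CosetSpace Γ |
          ENNReal.ofReal X < ENNReal.ofReal (Real.exp (-R)) * CuspHitting.hittingTime Γ g σ R x ∧
          ∃ w ∈ D, CuspHitting.IsFirstImpact Γ g σ R x w})
        Filter.atTop
        (nhds (∫ r in Set.Ioi X, ∫ w in D,
          CuspHitting.limitDensity Γ g σ r w ∂(CuspHitting.sectionMeasure σ))) := by
  open CuspHitting MeasureTheory in
  have hprob := isProbabilityMeasure_liouville (Γ := Γ) hmF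
  have hint {X : ℝ} (hX : 0 ≤ X) {D : Set (ℝ × ℝ × Fin K)} (hD : MeasurableSet D) :=
    hg.integrable_limitDensity (σ := σ) hF hneg hK hmF hX hD
  have hval {X : ℝ} (hX : 0 ≤ X) {D : Set (ℝ × ℝ × Fin K)} (hD : MeasurableSet D) :=
    hg.integral_limitDensity (σ := σ) hF hneg hK hmF hX hD
  refine ⟨⟨?_, ?_⟩, fun X hX D _ hD hDfr => ?_⟩
  · simpa only [Measure.restrict_univ] using hint le_rfl MeasurableSet.univ
  · rw [← (sectionMeasure σ).restrict_univ, hval le_rfl MeasurableSet.univ, measureReal_def,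
      hg.liouville_impactSet_zero_univ hF hneg hK hmF, ENNReal.toReal_one]
  · rw [← integral_prod _ (hint hX.le hD), hval hX.le hD]
    simp only [setOf_firstImpact_eq_image]
    exact (ENNReal.tendsto_toReal (measure_ne_top _ _)).comp
      (hadm _ (hg.measurableSet_impactSet hX.le hD)
        (hg.liouville_frontier_impactSet hF hneg hK hmF hX.le hDfr))
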